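/- Let $\mathbb F_q$ be a finite field with $q$ elements, let $N, M$ be positive integers, let $H$ be a vector space over $\mathbb F_q$ of dimension $N+M$, and let $h$ be a subspace of $H$ of dimension $M$. Let $X$ be the set of subspaces $y$ of $H$ with $y \cap h = 0$, partially ordered by inclusion (the Attenuated Space poset $\mathcal A_q(N,M)$). Let $A$ be the complex matrix with rows and columns indexed by $X$ whose $(y,z)$-entry is $1$ if $y$ covers $z$, is $q^{\dim y}$ if $z$ covers $y$, and is $0$ otherwise; it acts on $V = \mathbb C^X$ by left multiplication. Put $[N] = \{0, \tfrac12, 1, \tfrac32, \ldots, N\}$ and, for $i \in [N]$, $$\theta_i = \frac{q^{N-i}-q^i}{q-1}\, q^{M/2},$$ where $q^{1/2}$ is the positive square root, and let $E_iV$ denote the eigenspace of $A$ for the eigenvalue $\theta_i$. For integers $r, n \ge 0$ put $[n]_q = \frac{q^n-1}{q-1}$ and $[n]_q^! = \prod_{j=1}^n [j]_q$, with $\binom{n}{r}_q = \frac{[n]_q^!}{[r]_q^!\,[n-r]_q^!}$ if $r \le n$ and $\binom{n}{r}_q = 0$ if $r > n$, and $$\mu_r = \binom{N}{r}_q \binom{M}{r}_q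 \prod_{j=0}^{r-1} (q^r - q^j).$$ Then $\dim E_iV = \dim E_{N-i}V$ for all $i \in [N]$. Moreover, for $i \in [N]$ with $i \le N/2$ the following hold. (i) If $i \in \mathbb Z$, then $$\dim E_iV = \sum_{k=0}^{i} \mu_{2k} \binom{N-2k}{i-k}_q .$$ (ii) If $i \notin \mathbb Z$, then $$\dim E_iV = \sum_{k=0}^{i-1/2} \mu_{2k+1} \binom{N-2k-1}{i-k-1/2}_q .$$ -/

import Mathlib

namespace AttenuatedSpace

/-- The vertex set of the Attenuated Space poset determined by a subspace `h` of `H`: the subspaces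
of `H` that have zero intersection with `h`. It is partially ordered by inclusion (the order that a
subtype inherits from `Submodule F H`), and `y ⋖ z` means that `z` covers `y` in this poset. -/
abbrev Vertex {F H : Type*} [Field F] [AddCommGroup H] [Module F H] (h : Submodule F H) : Type _ :=
  {y : Submodule F H // y ⊓ h = ⊥}

/-- Over a finite field the poset is finite. -/
noncomputable instance instFintypeVertex {F H : Type*} [Field F] [Finite F] [AddCommGroup H]
    [Module F H] [FiniteDimensional F H] (h : Submodule F H) : Fintype (Vertex h) :=
  haveI : Finite H := Module.finite_of_finite F
  haveI : Finite (Submodule F H) := Finite.of_injective _ SetLike.coe_injective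
  Fintype.ofFinite _

noncomputable instance instDecidableEqVertex {F H : Type*} [Field F] [AddCommGroup H]
    [Module F H] (h : Submodule F H) : DecidableEq (Vertex h) :=
  Classical.decEq _

open Classical in
/-- The `q`-adjacency matrix `A`: its `(y, z)`-entry is `1` if `y` covers `z`, it is `q ^ dim y` if
`z` covers `y`, and it is `0` if neither of `y`, `z` covers the other; here `q` is the number of
elements of the field. -/
noncomputable def qAdjMatrix {F H : Type*} [Field F] [AddCommGroup H] [Module F H]
    (h : Submodule F H) : Matrix (Vertex h) (Vertex h) ℂ :=
  Matrix.of fun y z =>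
    if z ⋖ y then 1
    else if y ⋖ z then (Nat.card F : ℂ) ^ Module.finrank F y.1
    else 0

/-- The set `[N] = {0, 1/2, 1, 3/2, …, N}`. -/
def halfIntegersUpTo (N : ℕ) : Set ℝ :=
  {i | (∃ m : ℤ, 2 * i = m) ∧ 0 ≤ i ∧ i ≤ N}

/-- The scalar `θ_i = (q ^ (N - i) - q ^ i) / (q - 1) * q ^ (M / 2)`, with positive real powers
of `q`. -/
noncomputable def theta (q N M : ℕ) (i : ℝ) : ℝ :=
  ((q : ℝ) ^ ((N : ℝ) - i) - (q : ℝ) ^ i) / ((q : ℝ) - 1) * (q : ℝ) ^ ((M : ℝ) / 2)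

/-- The subspace `E_i V` of the standard module `V = ℂ^X`: the eigenspace of the `q`-adjacency
matrix for the eigenvalue `θ_i`. -/
noncomputable def eigenspaceEV {F H : Type*} [Field F] [Finite F] [AddCommGroup H] [Module F H]
    [FiniteDimensional F H] (h : Submodule F H) (N M : ℕ) (i : ℝ) :
    Submodule ℂ (Vertex h → ℂ) :=
  Module.End.eigenspace (Matrix.toLin' (qAdjMatrix h)) ((theta (Nat.card F) N M i : ℝ) : ℂ)

/-- `[n]_q = (q ^ n - 1) / (q - 1)`. -/
def qInt (q n : ℕ) : ℚ :=
  ((q : ℚ) ^ n - 1) / ((q : ℚ) - 1)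

/-- `[n]_q ! = [n]_q [n-1]_q ⋯ [1]_q`, with `[0]_q ! = 1`. -/
def qFactorial (q n : ℕ) : ℚ :=
  ∏ j ∈ Finset.range n, qInt q (j + 1)

/-- The `q`-binomial coefficient, which is `0` if `n < i`. -/
def qBinom (q n i : ℕ) : ℚ :=
  if i ≤ n then qFactorial q n / (qFactorial q i * qFactorial q (n - i)) else 0

/-- `μ_r = binom(N, r)_q * binom(M, r)_q * (q ^ r - 1) (q ^ r - q) ⋯ (q ^ r - q ^ (r - 1))`. -/
def mu (q N M r : ℕ) : ℚ :=
  qBinom q N r * qBinom q M r * ∏ j ∈ Finset.range r, ((q : ℚ) ^ r - (q : ℚ) ^ j)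

end AttenuatedSpace

/-!
The eigenspaces are found by exhibiting a basis of `ℂ^X` on which the `q`-adjacency matrix `A` is
triangular with explicit diagonal entries.

Write `W = H ⧸ h`. Choosing a projection of `H` onto `h` identifies a vertex `y` with a pair `(U,
φ)` of a subspace `U ≤ W` and a linear map `φ : U → h`. A nontrivial additive character `χ` of the
field turns each `ψ : h → W` with range in `U` into a character `φ ↦ χ (tr (φ ∘ ψ))`, the `phase`
of the vertex. For `S ≤ W` containing the range of `ψ`, let `w_{S,ψ}` be the function that at `(U,
φ)` is `x ^ dim U` times this phase if `S ≤ U`, and `0` otherwise (`phaseVec`).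

With `s = dim S`, `r = rank ψ` and `x = q ^ ((r - M) / 2 - s)`, counting covers gives `A w_{S,ψ} =
θ_{s - r/2} w_{S,ψ} + q ^ M x ∑ w_{S',ψ}`, the sum being over the hyperplanes `S'` of `S` that
contain the range of `ψ` (`mulVec_phaseVec`). At a vertex whose `U` does not contain the range of
`ψ` both sides vanish: on the left this holds because some shear of `H` along `h` fixes the
vertex, commutes with `A`, and multiplies `w_{S,ψ}` by a scalar other than `1`
(`mulVec_phaseVec_eq_zero`).

Restricting to the vertices over a minimal `S` and using independence of characters shows that the
`w_{S,ψ}` are independent (`linearIndependent_phaseVec`), and there are at least as many of them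
as vertices, since `Hom(U, h)` and `Hom(h, U)` are equinumerous (`card_vertex_le`). The diagonal
entries strictly decrease with `s - r/2`, so `A` is diagonalizable and the dimension of `E_i V` is
the number of pairs `(S, ψ)` with `s - r/2 = i` (`finrank_eigenspace_of_triangular`). There are
`μ_r` maps `ψ` of rank `r`, each contained in `binom(N - r, s - r)_q` subspaces `S` of dimension
`s`, whence the formulas; the symmetry `i ↦ N - i` is the symmetry of the `q`-binomial
coefficients.
-/

namespace AttenuatedSpace

open Module

/-! ### Counting subspaces over a finite field -/

lemma qFactorial_succ (q n : ℕ) : qFactorial q (n + 1) = qFactorial q n * qInt q (n + 1) :=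
  Finset.prod_range_succ _ _

lemma qFactorial_ne_zero {q : ℕ} (hq : 1 < q) (n : ℕ) : qFactorial q n ≠ 0 := by
  refine Finset.prod_ne_zero_iff.2 fun j _ => ?_
  have h1 : (1 : ℚ) < q := by exact_mod_cast hq
  have h2 : (1 : ℚ) < (q : ℚ) ^ (j + 1) := one_lt_pow₀ h1 (by omega)
  exact div_ne_zero (by linarith) (by linarith)

lemma prod_pow_sub_pow_mul_qFactorial {q : ℕ} (hq : 1 < q) (n k : ℕ) (hk : k ≤ n) :
    (∏ j ∈ Finset.range k, ((q : ℚ) ^ n - (q : ℚ) ^ j)) * qFactorial q (n - k)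
      = qFactorial q n * ∏ j ∈ Finset.range k, ((q : ℚ) ^ j * ((q : ℚ) - 1)) := by
  induction k with
  | zero => simp
  | succ k ih =>
    have h1 : (1 : ℚ) < q := by exact_mod_cast hq
    have h2 : (q : ℚ) - 1 ≠ 0 := by linarith
    have h3 : n - k = (n - (k + 1)) + 1 := by omega
    have h4 : (q : ℚ) ^ n = (q : ℚ) ^ k * (q : ℚ) ^ (n - (k + 1) + 1) := by
      rw [← pow_add]; congr 1; omega
    have h5 : (q : ℚ) ^ n - (q : ℚ) ^ k
        = (q : ℚ) ^ k * ((q : ℚ) - 1) * qInt q (n - (k + 1) + 1) := by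
      rw [qInt, h4]; field_simp
    have ih' := ih (by omega)
    rw [h3, qFactorial_succ] at ih'
    rw [Finset.prod_range_succ, Finset.prod_range_succ, h5, ← mul_assoc (qFactorial q n), ← ih']
    ring

/-- The number of ordered `k`-tuples of independent vectors in an `n`-dimensional space is the
number of `k`-dimensional subspaces times the number of ordered bases of each. -/
lemma prod_pow_sub_pow {q : ℕ} (hq : 1 < q) (n k : ℕ) :
    ∏ j ∈ Finset.range k, ((q : ℚ) ^ n - (q : ℚ) ^ j)
      = qBinom q n k * ∏ j ∈ Finset.range k, ((q : ℚ) ^ k - (q : ℚ) ^ j) := by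
  by_cases hk : k ≤ n
  · have h1 := prod_pow_sub_pow_mul_qFactorial hq n k hk
    have h2 := prod_pow_sub_pow_mul_qFactorial hq k k le_rfl
    have h3 := qFactorial_ne_zero hq
    rw [Nat.sub_self, show qFactorial q 0 = 1 by simp [qFactorial], mul_one] at h2
    rw [h2, qBinom, if_pos hk]
    have := h3 k
    have := h3 (n - k)
    field_simp
    linarith
  · rw [qBinom, if_neg hk, zero_mul]
    exact Finset.prod_eq_zero (Finset.mem_range.2 (not_le.1 hk)) (sub_self _)

lemma qBinom_one {q : ℕ} (hq : 1 < q) (n : ℕ) : qBinom q n 1 = qInt q n := by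
  have h1 := prod_pow_sub_pow hq n 1
  have h2 : (1 : ℚ) < q := by exact_mod_cast hq
  have h3 : (q : ℚ) - 1 ≠ 0 := by linarith
  simp only [Finset.prod_range_one, pow_zero, pow_one] at h1
  rw [qInt, h1]; field_simp

lemma qBinom_symm {q n k : ℕ} (hk : k ≤ n) : qBinom q n (n - k) = qBinom q n k := by
  rw [qBinom, qBinom, if_pos hk, if_pos (Nat.sub_le _ _), Nat.sub_sub_self hk, mul_comm]

lemma finrank_map_mkQ_add {F V : Type*} [Field F] [AddCommGroup V] [Module F V]
    [FiniteDimensional F V] {R z : Submodule F V} (h : R ≤ z) :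
    finrank F (z.map R.mkQ) + finrank F R = finrank F z := by
  have h1 := (R.mkQ.domRestrict z).finrank_range_add_finrank_ker
  rw [LinearMap.range_domRestrict, LinearMap.ker_domRestrict, Submodule.ker_mkQ,
    show finrank F (R.comap z.subtype) = finrank F R from
      (Submodule.submoduleOfEquivOfLe h).finrank_eq] at h1
  exact h1

section Counting

variable {F V : Type*} [Field F] [Finite F] [AddCommGroup V] [Module F V] [FiniteDimensional F V]

lemma card_linearIndependent_fin (k : ℕ) :
    (Nat.card {s : Fin k → V // LinearIndependent F s} : ℚ)
      = ∏ j ∈ Finset.range k, ((Nat.card F : ℚ) ^ finrank F V - (Nat.card F : ℚ) ^ j) := by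
  have := Fintype.ofFinite F
  have : Finite V := Module.finite_of_finite F
  by_cases hk : k ≤ finrank F V
  · rw [card_linearIndependent hk, Nat.cast_prod, ← Fin.prod_univ_eq_prod_range
      (fun j => ((Nat.card F : ℚ) ^ finrank F V - (Nat.card F : ℚ) ^ j))]
    refine Finset.prod_congr rfl fun j _ => ?_
    rw [Nat.card_eq_fintype_card, Nat.cast_sub (Nat.pow_le_pow_right Fintype.card_pos
      (j.2.le.trans hk))]
    push_cast; rfl
  · rw [Finset.prod_eq_zero (Finset.mem_range.2 (not_le.1 hk)) (sub_self _)]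
    have : IsEmpty {s : Fin k → V // LinearIndependent F s} :=
      ⟨fun s => hk (by simpa using s.2.fintype_card_le_finrank)⟩
    simp

lemma prod_pow_self_sub_pow_ne_zero {q : ℕ} (hq : 1 < q) (k : ℕ) :
    ∏ j ∈ Finset.range k, ((q : ℚ) ^ k - (q : ℚ) ^ j) ≠ 0 := by
  refine Finset.prod_ne_zero_iff.2 fun j hj => ?_
  have h2 : (1 : ℚ) < q := by exact_mod_cast hq
  exact sub_ne_zero.2 (pow_lt_pow_right₀ h2 (Finset.mem_range.1 hj)).ne'

/-- Independent tuples with a given span `S` of the right dimension are the ordered bases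
of `S`. -/
noncomputable def linearIndependentSpanEquiv {k : ℕ} (S : Submodule F V) (hS : finrank F S = k) :
    {s : {s : Fin k → V // LinearIndependent F s} // Submodule.span F (Set.range s.1) = S} ≃
      {t : Fin k → S // LinearIndependent F t} where
  toFun s := ⟨fun i => ⟨s.1.1 i, s.2.le (Submodule.subset_span ⟨i, rfl⟩)⟩,
    LinearIndependent.of_comp S.subtype s.1.2⟩
  invFun t := ⟨⟨fun i => t.1 i, t.2.map' S.subtype S.ker_subtype⟩, by
    have h1 : LinearIndependent F (fun i => (t.1 i : V)) := t.2.map' S.subtype S.ker_subtype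
    refine Submodule.eq_of_le_of_finrank_eq (Submodule.span_le.2 ?_) ?_
    · rintro _ ⟨i, rfl⟩; exact (t.1 i).2
    · rw [finrank_span_eq_card h1, hS, Fintype.card_fin]⟩
  left_inv _ := rfl
  right_inv _ := rfl

instance : Finite (Submodule F V) :=
  haveI : Finite V := Module.finite_of_finite F
  Finite.of_injective _ SetLike.coe_injective

lemma natCard_sigma_const {α : Type*} [Finite α] {β : α → Type*} [∀ a, Finite (β a)] {c : ℚ}
    (h : ∀ a, (Nat.card (β a) : ℚ) = c) : (Nat.card (Σ a, β a) : ℚ) = Nat.card α * c := by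
  have := Fintype.ofFinite α
  rw [Nat.card_sigma, Nat.cast_sum, Finset.sum_congr rfl fun a _ => h a]
  simp

theorem card_submodule_finrank_eq (k : ℕ) :
    (Nat.card {S : Submodule F V // finrank F S = k} : ℚ)
      = qBinom (Nat.card F) (finrank F V) k := by
  have hV : Finite V := Module.finite_of_finite F
  have hq : 1 < Nat.card F := Finite.one_lt_card
  let f : {s : Fin k → V // LinearIndependent F s} → {S : Submodule F V // finrank F S = k} :=
    fun s => ⟨Submodule.span F (Set.range s.1), by
      rw [finrank_span_eq_card s.2, Fintype.card_fin]⟩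
  have h1 : (Nat.card {s : Fin k → V // LinearIndependent F s} : ℚ)
      = Nat.card {S : Submodule F V // finrank F S = k}
        * ∏ j ∈ Finset.range k, ((Nat.card F : ℚ) ^ k - (Nat.card F : ℚ) ^ j) := by
    rw [← Nat.card_congr (Equiv.sigmaFiberEquiv f)]
    refine natCard_sigma_const fun S => ?_
    have e : {s // f s = S} ≃ {t : Fin k → S.1 // LinearIndependent F t} :=
      (Equiv.subtypeEquivRight fun s => Subtype.ext_iff).trans
        (linearIndependentSpanEquiv S.1 S.2)
    rw [Nat.card_congr e, card_linearIndependent_fin, S.2]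
  rw [card_linearIndependent_fin, prod_pow_sub_pow hq] at h1
  exact (mul_right_cancel₀ (prod_pow_self_sub_pow_ne_zero hq k) h1).symm

/-- Subspaces between `R` and `T` correspond to subspaces of `T / R`, here realised as the image of
`T` in the quotient by `R`. -/
noncomputable def intervalEquiv {R T : Submodule F V} (hRT : R ≤ T) (k : ℕ) :
    {z : Submodule F V // R ≤ z ∧ z ≤ T ∧ finrank F z = finrank F R + k} ≃
      {S : Submodule F (T.map R.mkQ) // finrank F S = k} where
  toFun z := ⟨(z.1.map R.mkQ).submoduleOf (T.map R.mkQ), by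
    have h1 := finrank_map_mkQ_add z.2.1
    rw [(Submodule.submoduleOfEquivOfLe (Submodule.map_mono z.2.2.1)).finrank_eq]
    have := z.2.2.2
    omega⟩
  invFun S := ⟨(S.1.map (T.map R.mkQ).subtype).comap R.mkQ, by
    have h0 : R ≤ (S.1.map (T.map R.mkQ).subtype).comap R.mkQ := by
      intro x hx
      rw [Submodule.mem_comap, Submodule.mkQ_apply, (Submodule.Quotient.mk_eq_zero R).2 hx]
      exact zero_mem _
    refine ⟨h0, ?_, ?_⟩
    · refine (Submodule.comap_mono (Submodule.map_subtype_le _ _)).trans ?_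
      rw [Submodule.comap_map_mkQ, sup_eq_right.2 hRT]
    · have h1 := finrank_map_mkQ_add h0
      rw [Submodule.map_comap_eq_of_surjective R.mkQ_surjective,
        Submodule.finrank_map_subtype_eq] at h1
      have := S.2
      omega⟩
  left_inv z := by
    apply Subtype.ext
    simp only
    rw [Submodule.submoduleOf, Submodule.map_comap_subtype,
      inf_eq_right.2 (Submodule.map_mono z.2.2.1), Submodule.comap_map_mkQ,
      sup_eq_right.2 z.2.1]
  right_inv S := by
    apply Subtype.ext
    simp only
    rw [Submodule.map_comap_eq_of_surjective R.mkQ_surjective, Submodule.submoduleOf,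
      Submodule.comap_map_eq_of_injective (Submodule.subtype_injective _)]

theorem card_interval {R T : Submodule F V} (hRT : R ≤ T) (k : ℕ) :
    (Nat.card {z : Submodule F V // R ≤ z ∧ z ≤ T ∧ finrank F z = finrank F R + k} : ℚ)
      = qBinom (Nat.card F) (finrank F T - finrank F R) k := by
  rw [Nat.card_congr (intervalEquiv hRT k), card_submodule_finrank_eq, ← finrank_map_mkQ_add hRT,
    Nat.add_sub_cancel]

lemma card_interval_upper {R T : Submodule F V} (hRT : R ≤ T) :
    (Nat.card {z : Submodule F V // R ≤ z ∧ z ≤ T ∧ finrank F z = finrank F R + 1} : ℚ)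
      = qInt (Nat.card F) (finrank F T - finrank F R) := by
  rw [card_interval hRT, qBinom_one Finite.one_lt_card]

lemma card_interval_lower {R T : Submodule F V} (hRT : R ≤ T) :
    (Nat.card {z : Submodule F V // R ≤ z ∧ z ≤ T ∧ finrank F z + 1 = finrank F T} : ℚ)
      = qInt (Nat.card F) (finrank F T - finrank F R) := by
  have hle := Submodule.finrank_mono hRT
  by_cases h : finrank F R = finrank F T
  · have : IsEmpty {z : Submodule F V // R ≤ z ∧ z ≤ T ∧ finrank F z + 1 = finrank F T} :=
      ⟨fun z => by have := Submodule.finrank_mono z.2.1; have := z.2.2.2; omega⟩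
    simp [h, qInt]
  · rw [← qBinom_one Finite.one_lt_card, ← qBinom_symm (by omega), ← card_interval hRT]
    congr 1
    refine Nat.card_congr (Equiv.subtypeEquivRight fun z => ?_)
    refine and_congr_right fun _ => and_congr_right fun _ => ?_
    omega

/-! ### Counting linear maps by rank -/

variable {U : Type*} [AddCommGroup U] [Module F U] [FiniteDimensional F U]

instance instFiniteHom : Finite (U →ₗ[F] V) :=
  haveI : Finite V := Module.finite_of_finite F
  haveI : Finite U := Module.finite_of_finite F
  Finite.of_injective _ DFunLike.coe_injective

/-- A linear map onto a space with a basis of size `k` is a `k`-tuple of independent functionals. -/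
lemma card_surjective :
    (Nat.card {f : U →ₗ[F] V // Function.Surjective f} : ℚ)
      = ∏ j ∈ Finset.range (finrank F V),
          ((Nat.card F : ℚ) ^ finrank F U - (Nat.card F : ℚ) ^ j) := by
  have key : Nat.card {f : U →ₗ[F] V // Function.Surjective f}
      = Nat.card {s : Fin (finrank F V) → Dual F U // LinearIndependent F s} := by
    let b := finBasis F V
    let e : (U →ₗ[F] V) ≃ (Fin (finrank F V) → Dual F U) :=
      { toFun := fun f i => b.coord i ∘ₗ f
        invFun := fun s => b.equivFun.symm.toLinearMap ∘ₗ LinearMap.pi s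
        left_inv := fun f => by
          ext x
          simp only [LinearMap.comp_apply, LinearEquiv.coe_coe]
          rw [LinearEquiv.symm_apply_eq]
          ext i
          simp
        right_inv := fun s => by
          ext i x
          simp [Finsupp.single_apply] }
    refine Nat.card_congr (e.subtypeEquiv fun f => ?_)
    rw [← LinearMap.dualMap_injective_iff]
    have h1 : e f = f.dualMap ∘ b.dualBasis := by
      ext i x
      simp [e]
    rw [h1]
    refine ⟨fun hf => b.dualBasis.linearIndependent.map' _ (LinearMap.ker_eq_bot.2 hf),
      fun hf => ?_⟩
    refine (injective_iff_map_eq_zero _).2 fun x hx => ?_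
    rw [← b.dualBasis.sum_repr x, map_sum] at hx
    simp only [map_smul] at hx
    refine b.dualBasis.ext_elem fun i => ?_
    simpa using Fintype.linearIndependent_iff.1 hf _ hx i
  rw [key, card_linearIndependent_fin, Subspace.dual_finrank_eq]

/-- `μ_r` counts the linear maps of rank `r`. -/
theorem card_finrank_range_eq (r : ℕ) :
    (Nat.card {f : U →ₗ[F] V // finrank F (LinearMap.range f) = r} : ℚ)
      = mu (Nat.card F) (finrank F V) (finrank F U) r := by
  let g : {f : U →ₗ[F] V // finrank F (LinearMap.range f) = r} →
      {S : Submodule F V // finrank F S = r} := fun f => ⟨LinearMap.range f.1, f.2⟩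
  rw [← Nat.card_congr (Equiv.sigmaFiberEquiv g), mu, mul_assoc,
    ← prod_pow_sub_pow Finite.one_lt_card, ← card_submodule_finrank_eq]
  refine natCard_sigma_const fun S => ?_
  let e : {f // g f = S} ≃ {f : U →ₗ[F] S.1 // Function.Surjective f} :=
    { toFun := fun f => ⟨LinearMap.codRestrict S.1 f.1.1 fun x =>
          (congrArg Subtype.val f.2).le (LinearMap.mem_range_self _ x), by
        rintro ⟨y, hy⟩
        obtain ⟨x, hx⟩ := (congrArg Subtype.val f.2).ge hy
        exact ⟨x, Subtype.ext hx⟩⟩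
      invFun := fun f => ⟨⟨S.1.subtype ∘ₗ f.1, by
          rw [LinearMap.range_comp, LinearMap.range_eq_top.2 f.2, Submodule.map_top,
            Submodule.range_subtype, S.2]⟩, Subtype.ext (by
          simp only [g]
          rw [LinearMap.range_comp, LinearMap.range_eq_top.2 f.2, Submodule.map_top,
            Submodule.range_subtype])⟩
      left_inv := fun f => rfl
      right_inv := fun f => rfl }
  rw [Nat.card_congr e, card_surjective, S.2]

end Counting

/-! ### Triangular operators with separated diagonal entries -/

section Triangular

variable {K V ι : Type*} [Field K] [AddCommGroup V] [Module K V] {T : End K V} {b : ι → V}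
  {θ : ι → K} {r : ι → ι → Prop}

/-- If `T` acts on the family `b` triangularly, and the diagonal entry at `i` differs from all
earlier ones, then `b i` can be corrected by earlier members of the family to an eigenvector. -/
theorem exists_eigenvector_of_triangular [IsTrans ι r] (hwf : WellFounded r)
    (hT : ∀ i, T (b i) - θ i • b i ∈ Submodule.span K (b '' {j | r j i}))
    (hθ : ∀ i j, r j i → θ j ≠ θ i) (i : ι) :
    ∃ u ∈ End.eigenspace T (θ i), b i - u ∈ Submodule.span K (b '' {j | r j i}) := by
  induction i using hwf.induction with
  | _ i ih =>
    set D := Submodule.span K (b '' {j | r j i}) with hD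
    set P := D.map (T - θ i • LinearMap.id) with hP
    -- `T - θ i` maps the span of the earlier members onto itself.
    have hsurj : ∀ j, r j i → b j ∈ P := by
      intro j
      induction j using hwf.induction with
      | _ j ihj =>
        intro hji
        obtain ⟨u, hu, hbu⟩ := ih j hji
        have hsub : Submodule.span K (b '' {k | r k j}) ≤ D :=
          Submodule.span_mono (Set.image_mono fun k hk => _root_.trans hk hji)
        have hsubP : Submodule.span K (b '' {k | r k j}) ≤ P := by
          rw [Submodule.span_le]
          rintro _ ⟨k, hk, rfl⟩
          exact ihj k hk (_root_.trans hk hji)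
        have hne : θ j - θ i ≠ 0 := sub_ne_zero.2 (hθ i j hji)
        have huD : u ∈ D := by
          have h1 : b j ∈ D := Submodule.subset_span ⟨j, hji, rfl⟩
          simpa using sub_mem h1 (hsub hbu)
        have huP : u ∈ P := by
          refine ⟨(θ j - θ i)⁻¹ • u, D.smul_mem _ huD, ?_⟩
          rw [map_smul, LinearMap.sub_apply, End.mem_eigenspace_iff.1 hu, LinearMap.smul_apply,
            LinearMap.id_apply, ← sub_smul, smul_smul, inv_mul_cancel₀ hne, one_smul]
        simpa using add_mem (hsubP hbu) huP
    have hDP : D ≤ P := by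
      rw [hD, Submodule.span_le]
      rintro _ ⟨j, hj, rfl⟩
      exact hsurj j hj
    obtain ⟨v, hv, hvd⟩ := hDP (hT i)
    refine ⟨b i - v, End.mem_eigenspace_iff.2 ?_, by simpa using hv⟩
    rw [LinearMap.sub_apply, LinearMap.smul_apply, LinearMap.id_apply] at hvd
    rw [map_sub, smul_sub, sub_eq_sub_iff_sub_eq_sub, ← hvd]

/-- For an operator with an eigenbasis, the dimension of an eigenspace is the number of basis
vectors in it. -/
theorem finrank_eigenspace_of_basis [Finite ι] (u : Basis ι K V)
    (hu : ∀ i, u i ∈ End.eigenspace T (θ i)) (μ : K) :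
    finrank K (End.eigenspace T μ) = Nat.card {i // θ i = μ} := by
  have := Fintype.ofFinite ι
  classical
  have hE : End.eigenspace T μ
      = Submodule.span K (Set.range fun i : {i // θ i = μ} => u i) := by
    refine le_antisymm (fun v hv => ?_) (Submodule.span_le.2 ?_)
    · have h1 : T v = ∑ i, (u.repr v i * θ i) • u i := by
        conv_lhs => rw [← u.sum_repr v]
        rw [map_sum]
        refine Finset.sum_congr rfl fun i _ => ?_
        rw [map_smul, End.mem_eigenspace_iff.1 (hu i), smul_smul]
      have h2 : ∀ i, u.repr v i ≠ 0 → θ i = μ := by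
        intro i hi
        have h3 : u.repr (T v) i = u.repr v i * θ i := by rw [h1, u.repr_sum_self]
        rw [End.mem_eigenspace_iff.1 hv, map_smul, Finsupp.smul_apply, smul_eq_mul, mul_comm] at h3
        exact (mul_left_cancel₀ hi h3).symm
      rw [← u.sum_repr v]
      refine Submodule.sum_mem _ fun i _ => ?_
      by_cases hi : u.repr v i = 0
      · rw [hi, zero_smul]; exact zero_mem _
      · exact Submodule.smul_mem _ _ (Submodule.subset_span ⟨⟨i, h2 i hi⟩, rfl⟩)
    · rintro _ ⟨i, rfl⟩
      have := hu i
      rwa [i.2] at this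
  have hli : LinearIndependent K fun i : {i // θ i = μ} => u i :=
    u.linearIndependent.comp _ Subtype.val_injective
  rw [hE, finrank_span_eq_card hli, Nat.card_eq_fintype_card]

/-- The corrected family of eigenvectors still spans, so it is an eigenbasis. -/
theorem finrank_eigenspace_of_triangular [Finite ι] [FiniteDimensional K V] [IsTrans ι r]
    (hwf : WellFounded r) (hb : LinearIndependent K b) (hcard : finrank K V ≤ Nat.card ι)
    (hT : ∀ i, T (b i) - θ i • b i ∈ Submodule.span K (b '' {j | r j i}))
    (hθ : ∀ i j, r j i → θ j ≠ θ i) (μ : K) :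
    finrank K (End.eigenspace T μ) = Nat.card {i // θ i = μ} := by
  have := Fintype.ofFinite ι
  rw [Nat.card_eq_fintype_card] at hcard
  have hcard' : Fintype.card ι = finrank K V := le_antisymm hb.fintype_card_le_finrank hcard
  choose u hu hbu using exists_eigenvector_of_triangular hwf hT hθ
  have hmem : ∀ i, b i ∈ Submodule.span K (Set.range u) := by
    intro i
    induction i using hwf.induction with
    | _ i ih =>
      have h1 : Submodule.span K (b '' {j | r j i}) ≤ Submodule.span K (Set.range u) := by
        rw [Submodule.span_le]
        rintro _ ⟨j, hj, rfl⟩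
        exact ih j hj
      simpa using add_mem (h1 (hbu i)) (Submodule.subset_span ⟨i, rfl⟩)
  have htop : ⊤ ≤ Submodule.span K (Set.range u) := by
    rw [← hb.span_eq_top_of_card_eq_finrank' hcard', Submodule.span_le]
    rintro _ ⟨i, rfl⟩
    exact hmem i
  exact finrank_eigenspace_of_basis (basisOfTopLeSpanOfCardEqFinrank u htop hcard')
    (fun i => by simpa using hu i) μ

end Triangular

/-! ### The image of a vertex in the quotient by `h` -/

section Vertices

variable {F H : Type*} [Field F] [AddCommGroup H] [Module F H] {h : Submodule F H}

/-- The image of a vertex in the quotient `H ⧸ h`; it has the same dimension as the vertex. -/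
def proj (y : Vertex h) : Submodule F (H ⧸ h) := y.1.map h.mkQ

lemma mkQ_injOn (y : Vertex h) {a : H} (ha : a ∈ y.1) (h0 : h.mkQ a = 0) : a = 0 := by
  have h1 : a ∈ y.1 ⊓ h := ⟨ha, (Submodule.Quotient.mk_eq_zero h).1 h0⟩
  rwa [y.2, Submodule.mem_bot] at h1

lemma proj_mono {y z : Vertex h} (hyz : y.1 ≤ z.1) : proj y ≤ proj z := Submodule.map_mono hyz

lemma mkQ_domRestrict_injective (y : Vertex h) : Function.Injective (h.mkQ.domRestrict y.1) :=
  (injective_iff_map_eq_zero _).2 fun a ha => Subtype.ext (mkQ_injOn y a.2 ha)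

lemma finrank_map_mkQ_of_le (y : Vertex h) {R : Submodule F H} (hR : R ≤ y.1) :
    finrank F (R.map h.mkQ) = finrank F R := by
  have h1 : Function.Injective (h.mkQ.domRestrict R) :=
    (injective_iff_map_eq_zero _).2 fun a ha => Subtype.ext (mkQ_injOn y (hR a.2) ha)
  rw [← LinearMap.finrank_range_of_inj h1, LinearMap.range_domRestrict]

lemma finrank_proj (y : Vertex h) : finrank F (proj y) = finrank F y.1 :=
  finrank_map_mkQ_of_le y le_rfl

lemma inf_eq_bot_of_le (y : Vertex h) {z : Submodule F H} (hz : z ≤ y.1) : z ⊓ h = ⊥ :=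
  eq_bot_iff.2 ((inf_le_inf_right _ hz).trans y.2.le)

lemma fixed_le_comap_mkQ (S : Submodule F (H ⧸ h)) : h ≤ S.comap h.mkQ := fun x hx => by
  rw [Submodule.mem_comap, Submodule.mkQ_apply, (Submodule.Quotient.mk_eq_zero h).2 hx]
  exact zero_mem _

variable [FiniteDimensional F H]

lemma covBy_iff {y z : Vertex h} :
    y ⋖ z ↔ y.1 ≤ z.1 ∧ finrank F z.1 = finrank F y.1 + 1 := by
  constructor
  · intro hyz
    refine ⟨hyz.le, ?_⟩
    have hlt : y.1 < z.1 := hyz.lt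
    obtain ⟨a, haz, hay⟩ := SetLike.exists_of_lt hlt
    have hle : y.1 ⊔ Submodule.span F {a} ≤ z.1 := sup_le hyz.le (by simpa using haz)
    let w : Vertex h := ⟨y.1 ⊔ Submodule.span F {a}, inf_eq_bot_of_le z hle⟩
    have hyw : y < w := by
      refine lt_of_le_of_ne (show y.1 ≤ w.1 from le_sup_left) fun he => hay ?_
      rw [he]
      exact (le_sup_right : Submodule.span F {a} ≤ w.1) (Submodule.mem_span_singleton_self a)
    have hwz : w = z := by
      by_contra hne
      exact hyz.2 hyw (lt_of_le_of_ne hle hne)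
    have h1 : finrank F z.1 ≤ finrank F y.1 + finrank F (Submodule.span F {a}) := by
      rw [← hwz]; exact Submodule.finrank_add_le_finrank_add_finrank _ _
    have h2 := finrank_span_le_card (R := F) ({a} : Set H)
    have h3 := Submodule.finrank_lt_finrank_of_lt hlt
    simp at h2
    omega
  · rintro ⟨hle, hf⟩
    refine ⟨lt_of_le_of_ne hle fun he => ?_, fun w hyw hwz => ?_⟩
    · rw [he] at hf; omega
    · have h1 := Submodule.finrank_lt_finrank_of_lt (show y.1 < w.1 from hyw)
      have h2 := Submodule.finrank_lt_finrank_of_lt (show w.1 < z.1 from hwz)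
      omega

lemma finrank_sup_fixed (y : Vertex h) :
    finrank F (y.1 ⊔ h : Submodule F H) = finrank F y.1 + finrank F h := by
  have h1 := Submodule.finrank_sup_add_finrank_inf_eq y.1 h
  rw [y.2, finrank_bot] at h1
  exact h1

lemma finrank_vertex_add_le (y : Vertex h) :
    finrank F y.1 + finrank F h ≤ finrank F H := by
  rw [← finrank_sup_fixed]; exact Submodule.finrank_le _

lemma finrank_comap_mkQ (S : Submodule F (H ⧸ h)) :
    finrank F (S.comap h.mkQ) = finrank F S + finrank F h := by
  have h1 := finrank_map_mkQ_add (R := h) (z := S.comap h.mkQ) fun x hx => by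
    rw [Submodule.mem_comap, Submodule.mkQ_apply, (Submodule.Quotient.mk_eq_zero h).2 hx]
    exact zero_mem _
  rw [Submodule.map_comap_eq_of_surjective h.mkQ_surjective] at h1
  exact h1.symm

/-! ### Counting covers -/

/-- A subspace of dimension one more than a vertex `y` containing `y` is again a vertex unless it
lies in `y ⊔ h`. -/
lemma inf_eq_bot_iff_not_le (y : Vertex h) {z : Submodule F H} (hyz : y.1 ≤ z)
    (hf : finrank F z = finrank F y.1 + 1) : z ⊓ h = ⊥ ↔ ¬ z ≤ y.1 ⊔ h := by
  have hz := Submodule.finrank_sup_add_finrank_inf_eq z h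
  have hle : y.1 ⊔ h ≤ z ⊔ h := sup_le_sup_right hyz h
  have hy := finrank_sup_fixed y
  constructor
  · intro h0 hzle
    rw [h0, finrank_bot] at hz
    have := Submodule.finrank_mono (sup_le hzle (le_sup_right : h ≤ y.1 ⊔ h))
    omega
  · intro hn
    have hlt : y.1 ⊔ h < z ⊔ h :=
      lt_of_le_of_ne hle fun he => hn (he ▸ le_sup_left)
    have := Submodule.finrank_lt_finrank_of_lt hlt
    exact Submodule.finrank_eq_zero.1 (by omega)

lemma card_covBy_upper_eq_zero (y : Vertex h) {S : Submodule F (H ⧸ h)}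
    (hS : finrank F y.1 + 1 < finrank F (proj y ⊔ S : Submodule F (H ⧸ h))) :
    Nat.card {z : Vertex h // y ⋖ z ∧ S ≤ proj z} = 0 := by
  have : IsEmpty {z : Vertex h // y ⋖ z ∧ S ≤ proj z} := by
    refine ⟨fun z => ?_⟩
    have hyz := covBy_iff.1 z.2.1
    have h1 := Submodule.finrank_mono (sup_le (proj_mono hyz.1) z.2.2)
    rw [finrank_proj, hyz.2] at h1
    omega
  exact Nat.card_of_isEmpty

lemma card_lower_inf_of_finrank_sup {W : Type*} [AddCommGroup W] [Module F W]
    [FiniteDimensional F W] {U S R : Submodule F W} (hRU : R ≤ U) (hRS : R ≤ S)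
    (hS : finrank F (U ⊔ S : Submodule F W) = finrank F U + 1) :
    Nat.card {S' : Submodule F W // (R ≤ S' ∧ S' ≤ S ∧ finrank F S' + 1 = finrank F S) ∧ S' ≤ U}
      = 1 := by
  have h1 := Submodule.finrank_sup_add_finrank_inf_eq U S
  rw [Nat.card_eq_one_iff_unique]
  refine ⟨⟨fun a b => ?_⟩, ⟨U ⊓ S, ⟨le_inf hRU hRS, inf_le_right, by omega⟩, inf_le_left⟩⟩
  have key : ∀ S' : {S' : Submodule F W //
      (R ≤ S' ∧ S' ≤ S ∧ finrank F S' + 1 = finrank F S) ∧ S' ≤ U}, S'.1 = U ⊓ S := fun S' =>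
    Submodule.eq_of_le_of_finrank_eq (le_inf S'.2.2 S'.2.1.2.1) (by
      have := S'.2.1.2.2; omega)
  exact Subtype.ext ((key a).trans (key b).symm)

lemma card_lower_inf_eq_zero {W : Type*} [AddCommGroup W] [Module F W]
    [FiniteDimensional F W] {U S R : Submodule F W}
    (hS : finrank F U + 1 < finrank F (U ⊔ S : Submodule F W)) :
    Nat.card {S' : Submodule F W // (R ≤ S' ∧ S' ≤ S ∧ finrank F S' + 1 = finrank F S) ∧ S' ≤ U}
      = 0 := by
  have : IsEmpty {S' : Submodule F W //
      (R ≤ S' ∧ S' ≤ S ∧ finrank F S' + 1 = finrank F S) ∧ S' ≤ U} := by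
    refine ⟨fun S' => ?_⟩
    have h1 := Submodule.finrank_sup_add_finrank_inf_eq U S
    have h2 := Submodule.finrank_mono (le_inf S'.2.2 S'.2.1.2.1)
    have := S'.2.1.2.2
    omega
  exact Nat.card_of_isEmpty

variable [Finite F]

lemma card_covBy_lower (y : Vertex h) {S : Submodule F (H ⧸ h)} (hS : S ≤ proj y) :
    (Nat.card {z : Vertex h // z ⋖ y ∧ S ≤ proj z} : ℚ)
      = qInt (Nat.card F) (finrank F y.1 - finrank F S) := by
  have hmap : (y.1 ⊓ S.comap h.mkQ).map h.mkQ = S := by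
    refine le_antisymm (Submodule.map_le_iff_le_comap.2 inf_le_right) fun x hx => ?_
    obtain ⟨a, ha, rfl⟩ := hS hx
    exact ⟨a, ⟨ha, hx⟩, rfl⟩
  have hfr : finrank F (y.1 ⊓ S.comap h.mkQ : Submodule F H) = finrank F S := by
    rw [← finrank_map_mkQ_of_le y inf_le_left, hmap]
  rw [← hfr, ← card_interval_lower inf_le_left]
  have hiff : ∀ z : Submodule F H, z ≤ y.1 →
      (S ≤ z.map h.mkQ ↔ y.1 ⊓ S.comap h.mkQ ≤ z) := by
    intro z hz
    constructor
    · rintro hSz a ⟨hay, haS⟩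
      obtain ⟨c, hc, hca⟩ := hSz haS
      have : a - c = 0 := mkQ_injOn y (sub_mem hay (hz hc)) (by rw [map_sub, hca, sub_self])
      rwa [sub_eq_zero.1 this]
    · intro hz'
      rw [← hmap]; exact Submodule.map_mono hz'
  refine congrArg Nat.cast (Nat.card_congr
    { toFun := fun z => ⟨z.1.1, (hiff _ (covBy_iff.1 z.2.1).1).1 z.2.2, (covBy_iff.1 z.2.1).1,
        (covBy_iff.1 z.2.1).2.symm⟩
      invFun := fun z => ⟨⟨z.1, inf_eq_bot_of_le y z.2.2.1⟩,
        covBy_iff.2 ⟨z.2.2.1, z.2.2.2.symm⟩, (hiff _ z.2.2.1).2 z.2.1⟩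
      left_inv := fun z => rfl
      right_inv := fun z => rfl })

/-- The subspaces of `T` of dimension one more than `y` that contain `y`, less those inside
`y ⊔ h`. -/
lemma card_covBy_upper (y : Vertex h) {T : Submodule F H} (hT : y.1 ⊔ h ≤ T) :
    (Nat.card {z : Vertex h // y ⋖ z ∧ z.1 ≤ T} : ℚ)
      = (Nat.card F : ℚ) ^ finrank F h
        * qInt (Nat.card F) (finrank F T - finrank F y.1 - finrank F h) := by
  have h1 := card_interval_upper ((le_sup_left : y.1 ≤ y.1 ⊔ h).trans hT)
  have h2 := card_interval_upper (le_sup_left : y.1 ≤ y.1 ⊔ h)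
  have hsplit : Nat.card {z : Submodule F H // y.1 ≤ z ∧ z ≤ T ∧
        finrank F z = finrank F y.1 + 1}
      = Nat.card {z : Vertex h // y ⋖ z ∧ z.1 ≤ T}
        + Nat.card {z : Submodule F H // y.1 ≤ z ∧ z ≤ y.1 ⊔ h ∧
            finrank F z = finrank F y.1 + 1} := by
    rw [← Nat.card_sum]
    classical
    refine Nat.card_congr ((Equiv.sumCompl fun z : {z : Submodule F H // y.1 ≤ z ∧ z ≤ T ∧
        finrank F z = finrank F y.1 + 1} => z.1 ⊓ h = ⊥).symm.trans (Equiv.sumCongr ?_ ?_))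
    · exact
        { toFun := fun z => ⟨⟨z.1.1, z.2⟩, covBy_iff.2 ⟨z.1.2.1, z.1.2.2.2⟩, z.1.2.2.1⟩
          invFun := fun z => ⟨⟨z.1.1, (covBy_iff.1 z.2.1).1, z.2.2, (covBy_iff.1 z.2.1).2⟩, z.1.2⟩
          left_inv := fun z => rfl
          right_inv := fun z => rfl }
    · exact
        { toFun := fun z => ⟨z.1.1, z.1.2.1, not_not.1 fun hn =>
            z.2 ((inf_eq_bot_iff_not_le y z.1.2.1 z.1.2.2.2).2 hn), z.1.2.2.2⟩
          invFun := fun z => ⟨⟨z.1, z.2.1, z.2.2.1.trans hT, z.2.2.2⟩, fun h0 =>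
            (inf_eq_bot_iff_not_le y z.2.1 z.2.2.2).1 h0 z.2.2.1⟩
          left_inv := fun z => rfl
          right_inv := fun z => rfl }
  have hy := finrank_sup_fixed y
  have hTf := Submodule.finrank_mono hT
  rw [hsplit, Nat.cast_add, h2, hy, Nat.add_sub_cancel_left] at h1
  rw [eq_sub_of_add_eq h1]
  have h3 : (1 : ℚ) < Nat.card F := by exact_mod_cast (Finite.one_lt_card : 1 < Nat.card F)
  have h4 : (Nat.card F : ℚ) - 1 ≠ 0 := by linarith
  have h5 : finrank F T - finrank F y.1
      = finrank F h + (finrank F T - finrank F y.1 - finrank F h) := by omega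
  rw [h5, qInt, qInt, qInt, pow_add, Nat.add_sub_cancel_left]
  field_simp
  ring

lemma card_covBy_upper_of_le (y : Vertex h) {S : Submodule F (H ⧸ h)} (hS : S ≤ proj y) :
    (Nat.card {z : Vertex h // y ⋖ z ∧ S ≤ proj z} : ℚ)
      = (Nat.card F : ℚ) ^ finrank F h
        * qInt (Nat.card F) (finrank F H - finrank F y.1 - finrank F h) := by
  rw [← finrank_top F H, ← card_covBy_upper y le_top]
  refine congrArg Nat.cast (Nat.card_congr (Equiv.subtypeEquivRight fun z =>
    and_congr_right fun hz => ?_))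
  simpa using hS.trans (proj_mono hz.le)

lemma card_covBy_upper_of_finrank_sup (y : Vertex h) {S : Submodule F (H ⧸ h)}
    (hS : finrank F (proj y ⊔ S : Submodule F (H ⧸ h)) = finrank F y.1 + 1) :
    (Nat.card {z : Vertex h // y ⋖ z ∧ S ≤ proj z} : ℚ) = (Nat.card F : ℚ) ^ finrank F h := by
  have hT : y.1 ⊔ h ≤ (proj y ⊔ S).comap h.mkQ :=
    sup_le (Submodule.map_le_iff_le_comap.1 le_sup_left) (fixed_le_comap_mkQ _)
  have h3 : (1 : ℚ) < Nat.card F := by exact_mod_cast (Finite.one_lt_card : 1 < Nat.card F)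
  have h4 : (Nat.card F : ℚ) - 1 ≠ 0 := by linarith
  have h1 := card_covBy_upper y hT
  rw [finrank_comap_mkQ, hS, show finrank F y.1 + 1 + finrank F h - finrank F y.1 - finrank F h = 1
    by omega, qInt, pow_one, div_self h4, mul_one] at h1
  rw [← h1]
  refine congrArg Nat.cast (Nat.card_congr (Equiv.subtypeEquivRight fun z =>
    and_congr_right fun hz => ?_))
  rw [← Submodule.map_le_iff_le_comap]
  have hyz := proj_mono (covBy_iff.1 hz).1
  have hfz := finrank_proj z
  rw [(covBy_iff.1 hz).2] at hfz
  constructor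
  · intro hSz
    exact (Submodule.eq_of_le_of_finrank_eq (sup_le hyz hSz) (by rw [hS, hfz])).ge
  · intro hzT
    have h5 : proj z = proj y ⊔ S := Submodule.eq_of_le_of_finrank_eq hzT (by rw [hS, hfz])
    rw [h5]; exact le_sup_right

lemma card_lower_inf_of_le {W : Type*} [AddCommGroup W] [Module F W]
    [FiniteDimensional F W] {U S R : Submodule F W} (hRS : R ≤ S) (hSU : S ≤ U) :
    (Nat.card {S' : Submodule F W //
      (R ≤ S' ∧ S' ≤ S ∧ finrank F S' + 1 = finrank F S) ∧ S' ≤ U} : ℚ)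
      = qInt (Nat.card F) (finrank F S - finrank F R) := by
  rw [← card_interval_lower hRS]
  refine congrArg Nat.cast (Nat.card_congr (Equiv.subtypeEquivRight fun z => ?_))
  exact and_iff_left_of_imp fun hz => hz.2.1.trans hSU

end Vertices

/-! ### Phases and shears -/

section Phase

variable {F H : Type*} [Field F] [AddCommGroup H] [Module F H] {h : Submodule F H}
  {ρ : H →ₗ[F] h}

lemma exists_slope (ρ : H →ₗ[F] h) (y : Vertex h) :
    ∃ τ : (H ⧸ h) →ₗ[F] h, ∀ a ∈ y.1, τ (h.mkQ a) = ρ a := by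
  obtain ⟨g, hg⟩ := (h.mkQ.domRestrict y.1).exists_leftInverse_of_injective
    (LinearMap.ker_eq_bot.2 (mkQ_domRestrict_injective y))
  refine ⟨ρ ∘ₗ y.1.subtype ∘ₗ g, fun a ha => ?_⟩
  have h1 : g (h.mkQ a) = ⟨a, ha⟩ := LinearMap.congr_fun hg ⟨a, ha⟩
  rw [LinearMap.comp_apply, LinearMap.comp_apply, h1]
  rfl

/-- Relative to a projection `ρ` of `H` onto `h`, a vertex `y` is the graph of a linear map from its
image in `H ⧸ h` to `h`. This is a chosen extension of that map to all of `H ⧸ h`. -/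
noncomputable def slope (ρ : H →ₗ[F] h) (y : Vertex h) : (H ⧸ h) →ₗ[F] h :=
  (exists_slope ρ y).choose

lemma slope_apply (ρ : H →ₗ[F] h) (y : Vertex h) {a : H} (ha : a ∈ y.1) :
    slope ρ y (h.mkQ a) = ρ a :=
  (exists_slope ρ y).choose_spec a ha

/-- The value at a vertex `y` of the additive character `τ ↦ χ (tr (τ ∘ ψ))`, evaluated at the
slope of `y`. It is meaningful, that is, independent of the chosen extension in `slope`, when
the range of `ψ` lies in `proj y`. -/
noncomputable def phase (χ : AddChar F ℂ) (ρ : H →ₗ[F] h) (ψ : h →ₗ[F] H ⧸ h) (y : Vertex h) : ℂ :=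
  χ (LinearMap.trace F h (slope ρ y ∘ₗ ψ))

variable {χ : AddChar F ℂ} {ψ : h →ₗ[F] H ⧸ h}

lemma phase_eq {y : Vertex h} (hψ : LinearMap.range ψ ≤ proj y) {τ : (H ⧸ h) →ₗ[F] h}
    (hτ : ∀ a ∈ y.1, τ (h.mkQ a) = ρ a) :
    phase χ ρ ψ y = χ (LinearMap.trace F h (τ ∘ₗ ψ)) := by
  have h1 : slope ρ y ∘ₗ ψ = τ ∘ₗ ψ := by
    ext v
    obtain ⟨a, ha, hav⟩ := hψ (LinearMap.mem_range_self ψ v)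
    rw [LinearMap.comp_apply, LinearMap.comp_apply, ← hav, hτ a ha, slope_apply ρ y ha]
  rw [phase, h1]

lemma phase_eq_of_le {y z : Vertex h} (hψ : LinearMap.range ψ ≤ proj y) (hyz : y.1 ≤ z.1) :
    phase χ ρ ψ z = phase χ ρ ψ y :=
  (phase_eq hψ fun _ ha => slope_apply ρ z (hyz ha)).symm

/-- The shear `x ↦ x + τ (x mod h)` of `H` along `h`. -/
noncomputable def shearMap (τ : (H ⧸ h) →ₗ[F] h) : H →ₗ[F] H :=
  LinearMap.id + h.subtype ∘ₗ τ ∘ₗ h.mkQ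

lemma shearMap_apply (τ : (H ⧸ h) →ₗ[F] h) (x : H) : shearMap τ x = x + τ (h.mkQ x) := rfl

lemma mkQ_coe (x : h) : h.mkQ (x : H) = 0 := (Submodule.Quotient.mk_eq_zero h).2 x.2

lemma mkQ_shearMap (τ : (H ⧸ h) →ₗ[F] h) (x : H) : h.mkQ (shearMap τ x) = h.mkQ x := by
  rw [shearMap_apply, map_add, mkQ_coe, add_zero]

lemma mkQ_comp_shearMap (τ : (H ⧸ h) →ₗ[F] h) : h.mkQ ∘ₗ shearMap τ = h.mkQ :=
  LinearMap.ext fun x => mkQ_shearMap τ x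

lemma shearMap_neg_comp (τ : (H ⧸ h) →ₗ[F] h) : shearMap (-τ) ∘ₗ shearMap τ = LinearMap.id := by
  ext x
  rw [LinearMap.comp_apply, shearMap_apply, mkQ_shearMap, shearMap_apply]
  simp

lemma shearMap_injective (τ : (H ⧸ h) →ₗ[F] h) : Function.Injective (shearMap τ) :=
  Function.LeftInverse.injective (g := shearMap (-τ)) fun x =>
    LinearMap.congr_fun (shearMap_neg_comp τ) x

/-- Shears permute the vertices. -/
noncomputable def shear (τ : (H ⧸ h) →ₗ[F] h) (y : Vertex h) : Vertex h :=
  ⟨y.1.map (shearMap τ), by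
    rw [eq_bot_iff]
    rintro _ ⟨⟨a, ha, rfl⟩, hah⟩
    have h1 : a = 0 := mkQ_injOn y ha (by
      rw [← mkQ_shearMap τ]; exact (Submodule.Quotient.mk_eq_zero h).2 hah)
    rw [h1, map_zero]; exact zero_mem _⟩

lemma shear_neg_shear (τ : (H ⧸ h) →ₗ[F] h) (y : Vertex h) : shear (-τ) (shear τ y) = y :=
  Subtype.ext (by
    change (y.1.map (shearMap τ)).map (shearMap (-τ)) = y.1
    rw [← Submodule.map_comp, shearMap_neg_comp, Submodule.map_id])

/-- A shear as a permutation of the vertices. -/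
noncomputable def shearEquiv (τ : (H ⧸ h) →ₗ[F] h) : Vertex h ≃ Vertex h where
  toFun := shear τ
  invFun := shear (-τ)
  left_inv := shear_neg_shear τ
  right_inv y := by simpa using shear_neg_shear (-τ) y

lemma proj_shear (τ : (H ⧸ h) →ₗ[F] h) (y : Vertex h) : proj (shear τ y) = proj y := by
  change (y.1.map (shearMap τ)).map h.mkQ = y.1.map h.mkQ
  rw [← Submodule.map_comp, mkQ_comp_shearMap]

lemma finrank_shear (τ : (H ⧸ h) →ₗ[F] h) (y : Vertex h) :
    finrank F (shear τ y).1 = finrank F y.1 := by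
  rw [← finrank_proj, proj_shear, finrank_proj]

lemma shear_eq_self {τ : (H ⧸ h) →ₗ[F] h} {y : Vertex h} (hτ : ∀ w ∈ proj y, τ w = 0) :
    shear τ y = y := by
  have h1 : ∀ a ∈ y.1, shearMap τ a = a := fun a ha => by
    rw [shearMap_apply, hτ _ ⟨a, ha, rfl⟩]; simp
  refine Subtype.ext (le_antisymm ?_ fun a ha => ⟨a, ha, h1 a ha⟩)
  rintro _ ⟨a, ha, rfl⟩
  rw [h1 a ha]; exact ha

lemma shear_le_shear_iff (τ : (H ⧸ h) →ₗ[F] h) {y z : Vertex h} :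
    (shear τ y).1 ≤ (shear τ z).1 ↔ y.1 ≤ z.1 :=
  Submodule.map_le_map_iff_of_injective (shearMap_injective τ) _ _

lemma phase_shear (hρ : ∀ x : h, ρ x = x) (τ : (H ⧸ h) →ₗ[F] h) {y : Vertex h}
    (hψ : LinearMap.range ψ ≤ proj y) :
    phase χ ρ ψ (shear τ y) = χ (LinearMap.trace F h (τ ∘ₗ ψ)) * phase χ ρ ψ y := by
  have h1 : ∀ a ∈ (shear τ y).1, (slope ρ y + τ) (h.mkQ a) = ρ a := by
    rintro _ ⟨a, ha, rfl⟩
    rw [mkQ_shearMap, LinearMap.add_apply, slope_apply ρ y ha, shearMap_apply, map_add, hρ]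
  rw [phase_eq (by rwa [proj_shear]) h1, LinearMap.add_comp, map_add, AddChar.map_add_eq_mul,
    mul_comm]
  rfl

lemma phase_ne_zero (y : Vertex h) : phase χ ρ ψ y ≠ 0 :=
  (χ.val_isUnit _).ne_zero

/-- The function supported on the vertices whose image in `H ⧸ h` contains `S`, with value
`x ^ dim y` times a phase. -/
noncomputable def phaseVec (χ : AddChar F ℂ) (ρ : H →ₗ[F] h) (x : ℂ) (S : Submodule F (H ⧸ h))
    (ψ : h →ₗ[F] H ⧸ h) (y : Vertex h) : ℂ :=
  open Classical in if S ≤ proj y then x ^ finrank F y.1 * phase χ ρ ψ y else 0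

lemma phaseVec_shear (hρ : ∀ x : h, ρ x = x) (τ : (H ⧸ h) →ₗ[F] h) (x : ℂ)
    {S : Submodule F (H ⧸ h)} (hψ : LinearMap.range ψ ≤ S) (y : Vertex h) :
    phaseVec χ ρ x S ψ (shear τ y)
      = χ (LinearMap.trace F h (τ ∘ₗ ψ)) * phaseVec χ ρ x S ψ y := by
  rw [phaseVec, phaseVec, proj_shear, finrank_shear]
  split_ifs with hS
  · rw [phase_shear hρ τ (hψ.trans hS)]; ring
  · rw [mul_zero]

variable [FiniteDimensional F H]

lemma covBy_shear_iff (τ : (H ⧸ h) →ₗ[F] h) {y z : Vertex h} :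
    shear τ y ⋖ shear τ z ↔ y ⋖ z := by
  rw [covBy_iff, covBy_iff, shear_le_shear_iff, finrank_shear, finrank_shear]

lemma qAdjMatrix_shear (τ : (H ⧸ h) →ₗ[F] h) (y z : Vertex h) :
    qAdjMatrix h (shear τ y) (shear τ z) = qAdjMatrix h y z := by
  classical
  rw [qAdjMatrix, Matrix.of_apply, Matrix.of_apply, finrank_shear]
  exact if_congr (covBy_shear_iff τ) rfl (if_congr (covBy_shear_iff τ) rfl rfl)

/-- The trace pairing separates a map `ψ` from the maps into a subspace not containing its range. -/
lemma exists_trace_eq {U : Submodule F (H ⧸ h)} (hψ : ¬ LinearMap.range ψ ≤ U) (c : F) :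
    ∃ τ : (H ⧸ h) →ₗ[F] h, (∀ w ∈ U, τ w = 0) ∧ LinearMap.trace F h (τ ∘ₗ ψ) = c := by
  obtain ⟨_, ⟨v, rfl⟩, hv⟩ := SetLike.not_le_iff_exists.1 hψ
  obtain ⟨f, hf, hfU⟩ := Submodule.exists_dual_map_eq_bot_of_notMem hv inferInstance
  refine ⟨((f (ψ v))⁻¹ * c) • f.smulRight v, fun w hw => ?_, ?_⟩
  · have : f w = 0 := by
      have h1 : f w ∈ U.map f := ⟨w, hw, rfl⟩
      rwa [hfU] at h1
    simp [this]
  · have h1 : (((f (ψ v))⁻¹ * c) • f.smulRight v) ∘ₗ ψ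
        = ((f (ψ v))⁻¹ * c) • (f ∘ₗ ψ).smulRight v := rfl
    rw [h1, map_smul, LinearMap.trace_smulRight, LinearMap.comp_apply, smul_eq_mul]
    field_simp

end Phase

/-! ### The action of the `q`-adjacency matrix -/

section Action

variable {F H : Type*} [Field F] [Finite F] [AddCommGroup H] [Module F H] [FiniteDimensional F H]
  {h : Submodule F H} {ρ : H →ₗ[F] h} {χ : AddChar F ℂ} {ψ : h →ₗ[F] H ⧸ h}

lemma mulVec_phaseVec_shear (hρ : ∀ x : h, ρ x = x) (τ : (H ⧸ h) →ₗ[F] h) (x : ℂ)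
    {S : Submodule F (H ⧸ h)} (hψ : LinearMap.range ψ ≤ S) (y : Vertex h) :
    (qAdjMatrix h).mulVec (phaseVec χ ρ x S ψ) (shear τ y)
      = χ (LinearMap.trace F h (τ ∘ₗ ψ)) * (qAdjMatrix h).mulVec (phaseVec χ ρ x S ψ) y := by
  rw [Matrix.mulVec, dotProduct, ← Equiv.sum_comp (shearEquiv τ), Matrix.mulVec, dotProduct,
    Finset.mul_sum]
  refine Finset.sum_congr rfl fun z _ => ?_
  change qAdjMatrix h (shear τ y) (shear τ z) * phaseVec χ ρ x S ψ (shear τ z) = _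
  rw [qAdjMatrix_shear, phaseVec_shear hρ τ x hψ]
  ring

/-- At a vertex whose image does not contain the range of `ψ`, a shear fixing that vertex shows that
the contributions of its upper covers cancel. -/
lemma mulVec_phaseVec_eq_zero (hρ : ∀ x : h, ρ x = x) (hχ : ∃ c, χ c ≠ 1) (x : ℂ)
    {S : Submodule F (H ⧸ h)} (hψ : LinearMap.range ψ ≤ S) {y : Vertex h}
    (hy : ¬ LinearMap.range ψ ≤ proj y) :
    (qAdjMatrix h).mulVec (phaseVec χ ρ x S ψ) y = 0 := by
  obtain ⟨c, hc⟩ := hχ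
  obtain ⟨τ, hτ, htr⟩ := exists_trace_eq hy c
  have h1 := mulVec_phaseVec_shear (χ := χ) hρ τ x hψ y
  rw [shear_eq_self hτ, htr] at h1
  by_contra h0
  exact hc (mul_right_cancel₀ h0 (by rw [one_mul]; exact h1.symm))

lemma mulVec_phaseVec_eq_card {x : ℂ} (hx : x ≠ 0) {S : Submodule F (H ⧸ h)}
    (hψ : LinearMap.range ψ ≤ S) {y : Vertex h} (hy : LinearMap.range ψ ≤ proj y) :
    (qAdjMatrix h).mulVec (phaseVec χ ρ x S ψ) y
      = x ^ finrank F y.1 * phase χ ρ ψ y *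
        (x⁻¹ * Nat.card {z : Vertex h // z ⋖ y ∧ S ≤ proj z}
          + (Nat.card F : ℂ) ^ finrank F y.1 * x
            * Nat.card {z : Vertex h // y ⋖ z ∧ S ≤ proj z}) := by
  classical
  have hterm : ∀ z, qAdjMatrix h y z * phaseVec χ ρ x S ψ z
      = x ^ finrank F y.1 * phase χ ρ ψ y *
        (x⁻¹ * (if z ⋖ y ∧ S ≤ proj z then 1 else 0)
          + (Nat.card F : ℂ) ^ finrank F y.1 * x * (if y ⋖ z ∧ S ≤ proj z then 1 else 0)) := by
    intro z
    rw [qAdjMatrix, Matrix.of_apply, phaseVec]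
    by_cases hS : S ≤ proj z
    · by_cases h1 : z ⋖ y
      · have h2 : ¬ y ⋖ z := fun h2 => lt_asymm h1.lt h2.lt
        rw [phase_eq_of_le (hψ.trans hS) h1.le, (covBy_iff.1 h1).2, pow_succ]
        simp only [h1, h2, hS, if_true, and_self, false_and, if_false]
        field_simp
        ring
      · by_cases h2 : y ⋖ z
        · rw [← phase_eq_of_le hy h2.le, (covBy_iff.1 h2).2, pow_succ]
          simp only [h1, h2, hS, if_true, and_self, false_and, if_false]
          ring
        · simp [h1, h2]
    · simp [hS]
  rw [Matrix.mulVec, dotProduct, Finset.sum_congr rfl fun z _ => hterm z, ← Finset.mul_sum,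
    Finset.sum_add_distrib, ← Finset.mul_sum, ← Finset.mul_sum, Finset.sum_boole,
    Finset.sum_boole, Nat.card_eq_fintype_card (α := {z : Vertex h // z ⋖ y ∧ S ≤ proj z}),
    Nat.card_eq_fintype_card (α := {z : Vertex h // y ⋖ z ∧ S ≤ proj z}), Fintype.card_subtype,
    Fintype.card_subtype]

end Action

/-! ### Pairs of a subspace and a linear map -/

section Pairs

variable {F H : Type*} [Field F] [AddCommGroup H] [Module F H] {h : Submodule F H}
  {ρ : H →ₗ[F] h} {χ : AddChar F ℂ}

/-- The pairs consisting of a subspace of `H ⧸ h` and a linear map from `h` to it; they index the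
triangular basis. -/
abbrev PairIndex (h : Submodule F H) : Type _ := Σ S : Submodule F (H ⧸ h), (h →ₗ[F] S)

/-- The second component of a pair, as a map into `H ⧸ h`. -/
def PairIndex.map (p : PairIndex h) : h →ₗ[F] H ⧸ h := p.1.subtype ∘ₗ p.2

lemma PairIndex.range_map_le (p : PairIndex h) : LinearMap.range p.map ≤ p.1 := by
  rintro _ ⟨v, rfl⟩; exact (p.2 v).2

lemma exists_retraction (h : Submodule F H) : ∃ ρ : H →ₗ[F] h, ∀ x : h, ρ x = x := by
  obtain ⟨ρ, hρ⟩ := h.subtype.exists_leftInverse_of_injective h.ker_subtype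
  exact ⟨ρ, fun x => LinearMap.congr_fun hρ x⟩

lemma exists_proj_eq (hρ : ∀ x : h, ρ x = x) (S : Submodule F (H ⧸ h)) :
    ∃ y : Vertex h, proj y = S := by
  refine ⟨⟨LinearMap.ker ρ ⊓ S.comap h.mkQ, ?_⟩, ?_⟩
  · rw [eq_bot_iff]
    rintro x ⟨⟨hx, -⟩, hxh⟩
    have h1 := hρ ⟨x, hxh⟩
    rw [show ρ (⟨x, hxh⟩ : h) = 0 from hx] at h1
    exact (congrArg Subtype.val h1).symm
  · refine le_antisymm (Submodule.map_le_iff_le_comap.2 inf_le_right) fun w hw => ?_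
    obtain ⟨a, rfl⟩ := h.mkQ_surjective w
    have h1 : h.mkQ (a - ρ a) = h.mkQ a := by rw [map_sub, mkQ_coe, sub_zero]
    refine ⟨a - ρ a, ⟨?_, ?_⟩, h1⟩
    · change ρ (a - ρ a) = 0
      rw [map_sub, hρ, sub_self]
    · change h.mkQ (a - ρ a) ∈ S
      rwa [h1]

/-- The additive character `τ ↦ χ (tr (τ ∘ ψ))`. -/
noncomputable def traceChar (χ : AddChar F ℂ) (ψ : h →ₗ[F] H ⧸ h) :
    AddChar ((H ⧸ h) →ₗ[F] h) ℂ :=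
  χ.compAddMonoidHom (LinearMap.trace F h ∘ₗ LinearMap.lcomp F h ψ).toAddMonoidHom

lemma traceChar_apply (ψ : h →ₗ[F] H ⧸ h) (τ : (H ⧸ h) →ₗ[F] h) :
    traceChar χ ψ τ = χ (LinearMap.trace F h (τ ∘ₗ ψ)) := rfl

lemma traceChar_injective [FiniteDimensional F H] (hχ : ∃ c, χ c ≠ 1) :
    Function.Injective (traceChar χ : (h →ₗ[F] H ⧸ h) → _) := by
  intro ψ φ heq
  obtain ⟨c, hc⟩ := hχ
  by_contra hne
  have h1 : ¬ LinearMap.range (ψ - φ) ≤ ⊥ := by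
    rw [le_bot_iff, LinearMap.range_eq_bot]; exact sub_ne_zero.2 hne
  obtain ⟨τ, -, hτ⟩ := exists_trace_eq h1 c
  have h2 := DFunLike.congr_fun heq τ
  rw [traceChar_apply, traceChar_apply, ← sub_add_cancel ψ φ, LinearMap.comp_add, map_add, hτ,
    AddChar.map_add_eq_mul] at h2
  exact hc (mul_right_cancel₀ (χ.val_isUnit _).ne_zero (by rw [one_mul]; exact h2))

lemma vertex_le_of_slope_eq (hρ : ∀ x : h, ρ x = x) {y z : Vertex h} (hp : proj y ≤ proj z)
    (hs : ∀ w ∈ proj y, slope ρ y w = slope ρ z w) : y.1 ≤ z.1 := by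
  intro a ha
  have hw : h.mkQ a ∈ proj y := ⟨a, ha, rfl⟩
  obtain ⟨c, hc, hca⟩ := hp hw
  have h1 : ρ a = ρ c := by
    rw [← slope_apply ρ y ha, hs _ hw, ← hca, slope_apply ρ z hc]
  have h2 : a - c ∈ h := by
    rw [← Submodule.Quotient.mk_eq_zero, ← Submodule.mkQ_apply, map_sub, hca, sub_self]
  have h3 := hρ ⟨a - c, h2⟩
  rw [show ρ ((⟨a - c, h2⟩ : h) : H) = 0 by rw [map_sub, h1, sub_self]] at h3
  have h4 : a - c = 0 := (congrArg Subtype.val h3).symm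
  rwa [sub_eq_zero.1 h4]

end Pairs

/-! ### Triangularity of the `q`-adjacency matrix -/

section Spectrum

variable {F H : Type*} [Field F] [Finite F] [AddCommGroup H] [Module F H] [FiniteDimensional F H]
  {h : Submodule F H} {ρ : H →ₗ[F] h} {χ : AddChar F ℂ} {ψ : h →ₗ[F] H ⧸ h}

/-- The hyperplanes of `S` that contain `R`. -/
noncomputable def hyperplanesAbove {W : Type*} [AddCommGroup W] [Module F W]
    [FiniteDimensional F W] (S R : Submodule F W) : Finset (Submodule F W) :=
  (Set.toFinite {S' | R ≤ S' ∧ S' ≤ S ∧ finrank F S' + 1 = finrank F S}).toFinset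

lemma mem_hyperplanesAbove {W : Type*} [AddCommGroup W] [Module F W] [FiniteDimensional F W]
    {S R S' : Submodule F W} :
    S' ∈ hyperplanesAbove S R ↔ R ≤ S' ∧ S' ≤ S ∧ finrank F S' + 1 = finrank F S := by
  simp [hyperplanesAbove]

lemma sum_phaseVec_hyperplanesAbove (x : ℂ) (S R : Submodule F (H ⧸ h)) (y : Vertex h) :
    ∑ S' ∈ hyperplanesAbove S R, phaseVec χ ρ x S' ψ y
      = x ^ finrank F y.1 * phase χ ρ ψ y
        * Nat.card {S' : Submodule F (H ⧸ h) //
            (R ≤ S' ∧ S' ≤ S ∧ finrank F S' + 1 = finrank F S) ∧ S' ≤ proj y} := by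
  classical
  rw [Nat.subtype_card ((hyperplanesAbove S R).filter fun S' => S' ≤ proj y)
    (fun S' => by rw [Finset.mem_filter, mem_hyperplanesAbove])]
  simp only [phaseVec]
  rw [← Finset.sum_filter, Finset.sum_const, nsmul_eq_mul, mul_comm]

/-- The scalar identity behind the triangular action: `j` and `i` are the codimensions of the range
of `ψ` in `S` and of `S` in the image of the vertex, and `k` is the corank of the vertex. -/
lemma diagonal_identity {Q x θ : ℂ} (hQ : Q ≠ 0) (hQ1 : Q - 1 ≠ 0) (hx : x ≠ 0) {M r i j k : ℕ}
    (hx2 : x ^ 2 * Q ^ (M + 2 * (r + j)) = Q ^ r)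
    (hθ : θ * (Q - 1) = x * Q ^ (r + j + i + M + k) - x⁻¹) (c : ℂ) :
    c * (x⁻¹ * ((Q ^ i - 1) / (Q - 1)) + Q ^ (r + j + i) * x * (Q ^ M * ((Q ^ k - 1) / (Q - 1))))
      = θ * c + Q ^ M * x * (Q ^ (r + j + i) * c * ((Q ^ j - 1) / (Q - 1))) := by
  have h1 : x ^ 2 * Q ^ (M + r + 2 * j) = 1 := by
    refine mul_right_cancel₀ (pow_ne_zero r hQ) ?_
    linear_combination hx2
  have h2 : θ = (x * Q ^ (r + j + i + M + k) - x⁻¹) / (Q - 1) := by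
    rw [← hθ, mul_div_assoc, div_self hQ1, mul_one]
  rw [h2]
  field_simp
  linear_combination -(c * Q ^ i) * h1

/-- The `q`-adjacency matrix is triangular on the functions `phaseVec`: the scalar `x` is determined
up to sign by requiring that the coefficients do not depend on the dimension of the vertex. -/
theorem mulVec_phaseVec (hρ : ∀ x : h, ρ x = x) (hχ : ∃ c, χ c ≠ 1) {x θ : ℂ} (hx : x ≠ 0)
    {S : Submodule F (H ⧸ h)} (hψ : LinearMap.range ψ ≤ S)
    (hx2 : x ^ 2 * (Nat.card F : ℂ) ^ (finrank F h + 2 * finrank F S)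
      = (Nat.card F : ℂ) ^ finrank F (LinearMap.range ψ))
    (hθ : θ * ((Nat.card F : ℂ) - 1) = x * (Nat.card F : ℂ) ^ finrank F H - x⁻¹) (y : Vertex h) :
    (qAdjMatrix h).mulVec (phaseVec χ ρ x S ψ) y
      = θ * phaseVec χ ρ x S ψ y + (Nat.card F : ℂ) ^ finrank F h * x
        * ∑ S' ∈ hyperplanesAbove S (LinearMap.range ψ),
            phaseVec χ ρ ((Nat.card F : ℂ) * x) S' ψ y := by
  have hq1 : (1 : ℚ) < Nat.card F := by exact_mod_cast (Finite.one_lt_card : 1 < Nat.card F)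
  have hq0 : (Nat.card F : ℂ) - 1 ≠ 0 := by
    have h1 : (Nat.card F : ℚ) - 1 ≠ 0 := by linarith
    exact_mod_cast h1
  by_cases hy : LinearMap.range ψ ≤ proj y
  · rw [mulVec_phaseVec_eq_card hx hψ hy, sum_phaseVec_hyperplanesAbove, mul_pow]
    have hdim := finrank_vertex_add_le y
    by_cases hS : S ≤ proj y
    · have c1 := congrArg (Rat.cast : ℚ → ℂ) (card_covBy_lower y hS)
      have c2 := congrArg (Rat.cast : ℚ → ℂ) (card_covBy_upper_of_le y hS)
      have c3 := congrArg (Rat.cast : ℚ → ℂ) (card_lower_inf_of_le hψ hS)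
      simp only [qInt] at c1 c2 c3
      push_cast at c1 c2 c3
      rw [c1, c2, c3, phaseVec, if_pos hS]
      have d1 := Submodule.finrank_mono hS
      have d2 := Submodule.finrank_mono hψ
      rw [finrank_proj] at d1
      obtain ⟨i, hi⟩ := Nat.exists_eq_add_of_le d1
      obtain ⟨j, hj⟩ := Nat.exists_eq_add_of_le d2
      obtain ⟨k, hk⟩ := Nat.exists_eq_add_of_le hdim
      rw [hj] at hi hx2
      rw [hi] at hk
      rw [hk] at hθ ⊢
      rw [hi, hj, Nat.add_sub_cancel_left, Nat.add_sub_cancel_left, Nat.sub_sub,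
        Nat.add_sub_cancel_left]
      have hQ : (Nat.card F : ℂ) ≠ 0 := Nat.cast_ne_zero.2 Nat.card_pos.ne'
      have := diagonal_identity hQ hq0 hx hx2 hθ (x ^ (finrank F (LinearMap.range ψ) + j + i)
        * phase χ ρ ψ y)
      rw [this]
      ring
    · rw [phaseVec, if_neg hS]
      have c1 : Nat.card {z : Vertex h // z ⋖ y ∧ S ≤ proj z} = 0 := by
        have : IsEmpty {z : Vertex h // z ⋖ y ∧ S ≤ proj z} :=
          ⟨fun z => hS (z.2.2.trans (proj_mono z.2.1.le))⟩
        exact Nat.card_of_isEmpty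
      have hlt : finrank F y.1 < finrank F (proj y ⊔ S : Submodule F (H ⧸ h)) := by
        rw [← finrank_proj]
        exact Submodule.finrank_lt_finrank_of_lt (left_lt_sup.2 hS)
      rcases Nat.lt_or_eq_of_le (Nat.succ_le_of_lt hlt) with h2 | h2
      · rw [c1, card_covBy_upper_eq_zero y h2,
          card_lower_inf_eq_zero (by rw [finrank_proj]; exact h2)]
        simp
      · have c2 := congrArg (Rat.cast : ℚ → ℂ) (card_covBy_upper_of_finrank_sup y h2.symm)
        push_cast at c2
        rw [c1, c2, card_lower_inf_of_finrank_sup hy hψ (by rw [finrank_proj]; exact h2.symm)]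
        push_cast
        ring
  · rw [mulVec_phaseVec_eq_zero hρ hχ x hψ hy, phaseVec, if_neg fun hS => hy (hψ.trans hS),
      Finset.sum_eq_zero fun S' hS' => ?_]
    · simp
    · rw [phaseVec, if_neg fun h1 => hy ((mem_hyperplanesAbove.1 hS').1.trans h1)]

/-! ### Independence -/

theorem linearIndependent_phaseVec (hρ : ∀ x : h, ρ x = x) (hχ : ∃ c, χ c ≠ 1)
    (x : PairIndex h → ℂ) (hx : ∀ p, x p ≠ 0) :
    LinearIndependent ℂ fun p : PairIndex h => phaseVec χ ρ (x p) p.1 p.map := by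
  have := Fintype.ofFinite (Submodule F (H ⧸ h))
  have (S : Submodule F (H ⧸ h)) := Fintype.ofFinite (h →ₗ[F] S)
  rw [Fintype.linearIndependent_iff]
  intro a ha
  suffices key : ∀ S : Submodule F (H ⧸ h), ∀ f : h →ₗ[F] S, a ⟨S, f⟩ = 0 from
    fun p => key p.1 p.2
  intro S
  induction S using WellFoundedLT.induction with
  | _ S ih =>
    obtain ⟨y, hy⟩ := exists_proj_eq hρ S
    -- On the vertices above `S`, only the pairs with first component `S` contribute.
    have h1 : ∀ τ : (H ⧸ h) →ₗ[F] h,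
        ∑ f : h →ₗ[F] S, (a ⟨S, f⟩ * (x ⟨S, f⟩ ^ finrank F y.1
          * phase χ ρ (PairIndex.map ⟨S, f⟩) y)) * traceChar χ (PairIndex.map ⟨S, f⟩) τ = 0 := by
      intro τ
      have h2 := congrFun ha (shear τ y)
      rw [Finset.sum_apply, Fintype.sum_sigma, Finset.sum_eq_single S] at h2
      · rw [Pi.zero_apply] at h2
        rw [← h2]
        refine Finset.sum_congr rfl fun f _ => ?_
        rw [Pi.smul_apply, smul_eq_mul, phaseVec_shear hρ τ _ (PairIndex.range_map_le _),
          phaseVec, if_pos hy.ge, traceChar_apply]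
        ring
      · intro S' _ hne
        refine Finset.sum_eq_zero fun f _ => ?_
        rw [Pi.smul_apply, smul_eq_mul, phaseVec]
        split_ifs with hle
        · rw [proj_shear, hy] at hle
          rw [ih S' (lt_of_le_of_ne hle hne), zero_mul]
        · rw [mul_zero]
      · exact fun hS => absurd (Finset.mem_univ _) hS
    have hinj : Function.Injective fun f : h →ₗ[F] S =>
        traceChar χ (PairIndex.map (⟨S, f⟩ : PairIndex h)) := by
      intro f g hfg
      have h3 := traceChar_injective hχ hfg
      ext v
      exact congrArg _ (Subtype.ext (LinearMap.congr_fun h3 v))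
    have hli := (AddChar.linearIndependent ((H ⧸ h) →ₗ[F] h) ℂ).comp _ hinj
    intro f
    have h4 := Fintype.linearIndependent_iff.1 hli _ (funext fun τ => by
      rw [Finset.sum_apply]; exact h1 τ) f
    exact (mul_eq_zero.1 h4).resolve_right
      (mul_ne_zero (pow_ne_zero _ (hx _)) (phase_ne_zero _))

/-- A vertex is determined by its image `S` in `H ⧸ h` and its slope `S → h`, and there are as many
linear maps `S → h` as maps `h → S`. -/
lemma card_vertex_le (hρ : ∀ x : h, ρ x = x) : Nat.card (Vertex h) ≤ Nat.card (PairIndex h) := by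
  have := Fintype.ofFinite (Submodule F (H ⧸ h))
  have h1 : Nat.card (PairIndex h) = Nat.card (Σ S : Submodule F (H ⧸ h), (S →ₗ[F] h)) := by
    rw [Nat.card_sigma, Nat.card_sigma]
    refine Finset.sum_congr rfl fun S _ => ?_
    rw [Module.natCard_eq_pow_finrank (K := F),
      Module.natCard_eq_pow_finrank (K := F) (V := S →ₗ[F] h), finrank_linearMap, finrank_linearMap,
      mul_comm]
  rw [h1]
  have h2 : ∀ p p' : Σ S : Submodule F (H ⧸ h), (S →ₗ[F] h), p = p' →
      ∀ w hw hw', p.2 ⟨w, hw⟩ = p'.2 ⟨w, hw'⟩ := by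
    rintro p _ rfl w _ _; rfl
  refine Nat.card_le_card_of_injective
    (fun y => (⟨proj y, slope ρ y ∘ₗ (proj y).subtype⟩ : Σ S : Submodule F (H ⧸ h), (S →ₗ[F] h)))
    fun y z hyz => Subtype.ext (le_antisymm ?_ ?_)
  · exact vertex_le_of_slope_eq hρ (congrArg Sigma.fst hyz).le fun w hw =>
      h2 _ _ hyz w hw ((congrArg Sigma.fst hyz).le hw)
  · exact vertex_le_of_slope_eq hρ (congrArg Sigma.fst hyz).ge fun w hw =>
      h2 _ _ hyz.symm w hw ((congrArg Sigma.fst hyz).ge hw)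

end Spectrum

/-! ### The eigenvalues -/

lemma theta_strictAnti {q : ℕ} (hq : 1 < q) (N M : ℕ) : StrictAnti (theta q N M) := by
  intro i j hij
  have hq' : (1 : ℝ) < q := by exact_mod_cast hq
  have h1 : (q : ℝ) ^ ((N : ℝ) - j) < (q : ℝ) ^ ((N : ℝ) - i) :=
    Real.rpow_lt_rpow_of_exponent_lt hq' (by linarith)
  have h2 : (q : ℝ) ^ i < (q : ℝ) ^ j := Real.rpow_lt_rpow_of_exponent_lt hq' hij
  refine mul_lt_mul_of_pos_right ?_ (Real.rpow_pos_of_pos (by linarith) _)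
  exact div_lt_div_of_pos_right (by linarith) (by linarith)

/-- The scalar `q ^ ((r - M) / 2 - s)` that makes the `q`-adjacency matrix triangular, for pairs
whose subspace has dimension `s` and whose map has rank `r`. -/
noncomputable def scale (q M s r : ℕ) : ℝ := (q : ℝ) ^ (((r : ℝ) - M) / 2 - s)

lemma scale_pos {q : ℕ} (hq : 1 < q) (M s r : ℕ) : 0 < scale q M s r :=
  Real.rpow_pos_of_pos (by positivity) _

lemma mul_scale_succ {q : ℕ} (hq : 1 < q) (M s r : ℕ) :
    (q : ℝ) * scale q M (s + 1) r = scale q M s r := by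
  have hq0 : (0 : ℝ) < q := by positivity
  rw [scale, scale]
  nth_rewrite 1 [← Real.rpow_one (q : ℝ)]
  rw [← Real.rpow_add hq0]
  congr 1; push_cast; ring

lemma scale_sq_mul {q : ℕ} (hq : 1 < q) (M s r : ℕ) :
    scale q M s r ^ 2 * (q : ℝ) ^ (M + 2 * s) = (q : ℝ) ^ r := by
  have hq0 : (0 : ℝ) < q := by positivity
  rw [scale, ← Real.rpow_natCast, ← Real.rpow_natCast, ← Real.rpow_natCast,
    ← Real.rpow_mul hq0.le, ← Real.rpow_add hq0]
  congr 1; push_cast; ring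

lemma theta_mul_sub_one {q : ℕ} (hq : 1 < q) (N M s r : ℕ) :
    theta q N M ((s : ℝ) - r / 2) * ((q : ℝ) - 1)
      = scale q M s r * (q : ℝ) ^ (N + M) - (scale q M s r)⁻¹ := by
  have hq0 : (0 : ℝ) < q := by positivity
  have hq1 : (q : ℝ) - 1 ≠ 0 := by
    have : (1 : ℝ) < q := by exact_mod_cast hq
    linarith
  have h1 : theta q N M ((s : ℝ) - r / 2) * ((q : ℝ) - 1)
      = (q : ℝ) ^ ((N : ℝ) - ((s : ℝ) - r / 2)) * (q : ℝ) ^ ((M : ℝ) / 2)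
        - (q : ℝ) ^ ((s : ℝ) - r / 2) * (q : ℝ) ^ ((M : ℝ) / 2) := by
    rw [theta]; field_simp
  rw [h1, scale, ← Real.rpow_neg hq0.le, ← Real.rpow_natCast, ← Real.rpow_add hq0,
    ← Real.rpow_add hq0, ← Real.rpow_add hq0]
  congr 2 <;> push_cast <;> ring

section Spectrum

variable {F H : Type*} [Field F] [Finite F] [AddCommGroup H] [Module F H] [FiniteDimensional F H]
  {h : Submodule F H}

/-- The rank of the second component of a pair. -/
noncomputable def PairIndex.rank (p : PairIndex h) : ℕ := finrank F (LinearMap.range p.map)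

lemma exists_addChar_ne_one (F : Type*) [Field F] [Finite F] :
    ∃ χ : AddChar F ℂ, ∃ c, χ c ≠ 1 := by
  obtain ⟨χ, hχ⟩ := AddChar.exists_apply_ne_zero.2 (one_ne_zero (α := F))
  exact ⟨χ, 1, hχ⟩

/-- The eigenvalue attached to a pair is `θ_{s - r/2}`, with `s` the dimension of its subspace and
`r` its rank. -/
theorem finrank_eigenspace_eq_card (N M : ℕ) (hH : finrank F H = N + M) (hh : finrank F h = M)
    (i : ℝ) :
    finrank ℂ (eigenspaceEV h N M i)
      = Nat.card {p : PairIndex h // (finrank F p.1 : ℝ) - p.rank / 2 = i} := by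
  obtain ⟨χ, hχ⟩ := exists_addChar_ne_one F
  obtain ⟨ρ, hρ⟩ := exists_retraction h
  have hq : 1 < Nat.card F := Finite.one_lt_card
  let x : PairIndex h → ℂ := fun p => (scale (Nat.card F) M (finrank F p.1) p.rank : ℝ)
  have hx : ∀ p, x p ≠ 0 := fun p => Complex.ofReal_ne_zero.2 (scale_pos hq _ _ _).ne'
  let θ : PairIndex h → ℂ := fun p =>
    (theta (Nat.card F) N M ((finrank F p.1 : ℝ) - p.rank / 2) : ℝ)
  let r : PairIndex h → PairIndex h → Prop := fun p p' => p.1 < p'.1 ∧ p.map = p'.map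
  have htrans : IsTrans (PairIndex h) r :=
    ⟨fun a b c hab hbc => ⟨hab.1.trans hbc.1, hab.2.trans hbc.2⟩⟩
  have hirrefl : Std.Irrefl r := ⟨fun a ha => lt_irrefl _ ha.1⟩
  have key := finrank_eigenspace_of_triangular (T := Matrix.toLin' (qAdjMatrix h)) (θ := θ)
    (b := fun p : PairIndex h => phaseVec χ ρ (x p) p.1 p.map) (r := r)
    (Finite.wellFounded_of_trans_of_irrefl r)
    (linearIndependent_phaseVec hρ hχ x hx)
    (by rw [finrank_fintype_fun_eq_card, ← Nat.card_eq_fintype_card]; exact card_vertex_le hρ)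
    ?_ ?_ ((theta (Nat.card F) N M i : ℝ) : ℂ)
  · rw [eigenspaceEV, key]
    refine Nat.card_congr (Equiv.subtypeEquivRight fun p => ?_)
    exact Complex.ofReal_inj.trans (theta_strictAnti hq N M).injective.eq_iff
  · intro p
    have h1 : Matrix.toLin' (qAdjMatrix h) (phaseVec χ ρ (x p) p.1 p.map)
        - θ p • phaseVec χ ρ (x p) p.1 p.map
        = ((Nat.card F : ℂ) ^ finrank F h * x p) •
          ∑ S' ∈ hyperplanesAbove p.1 (LinearMap.range p.map),
            phaseVec χ ρ ((Nat.card F : ℂ) * x p) S' p.map := by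
      have e1 : x p ^ 2 * (Nat.card F : ℂ) ^ (M + 2 * finrank F p.1)
          = (Nat.card F : ℂ) ^ p.rank := by
        simp only [x]
        exact_mod_cast scale_sq_mul hq M (finrank F p.1) p.rank
      have e2 : θ p * ((Nat.card F : ℂ) - 1)
          = x p * (Nat.card F : ℂ) ^ (N + M) - (x p)⁻¹ := by
        have := congrArg Complex.ofReal (theta_mul_sub_one hq N M (finrank F p.1) p.rank)
        push_cast at this
        exact this
      rw [sub_eq_iff_eq_add']
      ext y
      rw [Matrix.toLin'_apply, mulVec_phaseVec hρ hχ (hx p) p.range_map_le (θ := θ p)]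
      · simp [Finset.sum_apply]
      · rw [hh]; exact e1
      · rw [hH]; exact e2
    rw [h1]
    refine Submodule.smul_mem _ _ (Submodule.sum_mem _ fun S' hS' => Submodule.subset_span ?_)
    obtain ⟨hR, hle, hf⟩ := mem_hyperplanesAbove.1 hS'
    let p' : PairIndex h := ⟨S', p.map.codRestrict S' fun v => hR (LinearMap.mem_range_self _ v)⟩
    have hmap : p'.map = p.map := rfl
    refine ⟨p', ⟨lt_of_le_of_ne hle fun he => ?_, hmap⟩, ?_⟩
    · have : S' = p.1 := he
      rw [this] at hf; omega
    · have hx' : x p' = (Nat.card F : ℂ) * x p := by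
        have := congrArg Complex.ofReal (mul_scale_succ hq M (finrank F S') p.rank)
        rw [hf] at this
        push_cast at this
        exact this.symm
      simp only [hx', hmap]
      rfl
  · rintro p p' ⟨hlt, hmap⟩ he
    have h1 := (theta_strictAnti hq N M).injective (Complex.ofReal_injective he)
    have hr : p'.rank = p.rank := by rw [PairIndex.rank, PairIndex.rank, hmap]
    have hs : (finrank F p'.1 : ℝ) < finrank F p.1 :=
      Nat.cast_lt.2 (Submodule.finrank_lt_finrank_of_lt hlt)
    rw [hr] at h1
    linarith

/-! ### Counting pairs -/

lemma card_pairIndex (s r : ℕ) :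
    (Nat.card {p : PairIndex h // p.rank = r ∧ finrank F p.1 = r + s} : ℚ)
      = mu (Nat.card F) (finrank F (H ⧸ h)) (finrank F h) r
        * qBinom (Nat.card F) (finrank F (H ⧸ h) - r) s := by
  let e : {p : PairIndex h // p.rank = r ∧ finrank F p.1 = r + s} ≃
      Σ f : {f : h →ₗ[F] H ⧸ h // finrank F (LinearMap.range f) = r},
        {S : Submodule F (H ⧸ h) // LinearMap.range f.1 ≤ S ∧ S ≤ ⊤ ∧
          finrank F S = finrank F (LinearMap.range f.1) + s} :=
    { toFun := fun p => ⟨⟨p.1.map, p.2.1⟩, p.1.1, p.1.range_map_le, le_top, by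
        exact p.2.2.trans (congrArg (· + s) p.2.1.symm)⟩
      invFun := fun p => ⟨⟨p.2.1, p.1.1.codRestrict p.2.1 fun v =>
        p.2.2.1 (LinearMap.mem_range_self _ v)⟩, p.1.2, by rw [p.2.2.2.2, p.1.2]⟩
      left_inv := fun p => rfl
      right_inv := fun p => rfl }
  rw [Nat.card_congr e, ← card_finrank_range_eq]
  refine natCard_sigma_const fun f => ?_
  rw [card_interval le_top, finrank_top, f.2]

end Spectrum

/-! ### Evaluating the multiplicities -/

/-- The multiplicity of the eigenvalue `θ_{a/2}`. The term for `r` and `j` counts the pairs of rank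
`r` whose subspace has dimension `r + j`; they have `s - r/2 = (r + 2 j) / 2`. -/
def multiplicity (q N M a : ℕ) : ℚ :=
  ∑ r ∈ Finset.range (N + 1), ∑ j ∈ Finset.range (N - r + 1),
    if r + 2 * j = a then mu q N M r * qBinom q (N - r) j else 0

lemma multiplicity_symm {q N M a : ℕ} (ha : a ≤ 2 * N) :
    multiplicity q N M a = multiplicity q N M (2 * N - a) := by
  refine Finset.sum_congr rfl fun r hr => ?_
  have hr' := Finset.mem_range.1 hr
  rw [← Finset.sum_range_reflect]
  refine Finset.sum_congr rfl fun j hj => ?_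
  have hj' := Finset.mem_range.1 hj
  rw [show N - r + 1 - 1 - j = N - r - j by omega, qBinom_symm (by omega)]
  exact if_congr (by omega) rfl rfl

lemma multiplicity_eq_sum {q N M n ε : ℕ} (hε : ε < 2) (hn : 2 * n + ε ≤ N) :
    multiplicity q N M (2 * n + ε)
      = ∑ k ∈ Finset.range (n + 1),
          mu q N M (2 * k + ε) * qBinom q (N - (2 * k + ε)) (n - k) := by
  rw [multiplicity, Finset.sum_sigma', ← Finset.sum_filter]
  refine Finset.sum_nbij' (fun p => p.1 / 2) (fun k => ⟨2 * k + ε, n - k⟩) ?_ ?_ ?_ ?_ ?_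
  · rintro ⟨r, j⟩ hp
    simp only [Finset.mem_filter, Finset.mem_sigma, Finset.mem_range] at hp ⊢
    omega
  · intro k hk
    simp only [Finset.mem_filter, Finset.mem_sigma, Finset.mem_range] at hk ⊢
    omega
  · rintro ⟨r, j⟩ hp
    simp only [Finset.mem_filter, Finset.mem_sigma, Finset.mem_range] at hp
    have h1 : 2 * (r / 2) + ε = r := by omega
    have h2 : n - r / 2 = j := by omega
    simp only [h1, h2]
  · intro k _
    simp only
    omega
  · rintro ⟨r, j⟩ hp
    simp only [Finset.mem_filter, Finset.mem_sigma, Finset.mem_range] at hp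
    have h1 : 2 * (r / 2) + ε = r := by omega
    have h2 : n - r / 2 = j := by omega
    simp only [h1, h2]

theorem finrank_eigenspace_eq_multiplicity {F H : Type*} [Field F] [Finite F] [AddCommGroup H]
    [Module F H] [FiniteDimensional F H] {h : Submodule F H} (N M : ℕ)
    (hH : finrank F H = N + M) (hh : finrank F h = M) {i : ℝ} {a : ℕ} (ha : 2 * i = a) :
    (finrank ℂ (eigenspaceEV h N M i) : ℚ) = multiplicity (Nat.card F) N M a := by
  classical
  have := Fintype.ofFinite (Submodule F (H ⧸ h))
  have (S : Submodule F (H ⧸ h)) := Fintype.ofFinite (h →ₗ[F] S)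
  have hN : finrank F (H ⧸ h) = N := by
    have := h.finrank_quotient_add_finrank; omega
  have hiff : ∀ p : PairIndex h, (finrank F p.1 : ℝ) - p.rank / 2 = i ↔
      2 * finrank F p.1 = a + p.rank := fun p => by
    have h1 : (2 * finrank F p.1 = a + p.rank) ↔ (2 * (finrank F p.1 : ℝ) = a + p.rank) := by
      exact_mod_cast Iff.rfl
    rw [h1, ← ha]
    constructor <;> intro h2 <;> linarith
  have hterm : ∀ r s, mu (Nat.card F) N M r * qBinom (Nat.card F) (N - r) s
      = ∑ p : PairIndex h, if p.rank = r ∧ finrank F p.1 = r + s then (1 : ℚ) else 0 := by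
    intro r s
    have h1 := card_pairIndex (h := h) s r
    rw [hN, hh] at h1
    rw [← h1, Finset.sum_boole, Nat.card_eq_fintype_card, Fintype.card_subtype]
  have hcard : (Nat.card {p : PairIndex h // 2 * finrank F p.1 = a + p.rank} : ℚ)
      = ∑ p : PairIndex h, if 2 * finrank F p.1 = a + p.rank then (1 : ℚ) else 0 := by
    rw [Finset.sum_boole, Nat.card_eq_fintype_card, Fintype.card_subtype]
  rw [finrank_eigenspace_eq_card N M hH hh, Nat.card_congr (Equiv.subtypeEquivRight hiff), hcard,
    multiplicity]
  have hsum : ∀ r j, (if r + 2 * j = a then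
        mu (Nat.card F) N M r * qBinom (Nat.card F) (N - r) j else 0)
      = ∑ p : PairIndex h, if r + 2 * j = a ∧ p.rank = r ∧ finrank F p.1 = r + j
          then (1 : ℚ) else 0 := by
    intro r j
    rw [hterm]
    by_cases hc : r + 2 * j = a <;> simp [hc]
  simp only [hsum]
  rw [Finset.sum_congr rfl fun r _ => Finset.sum_comm, Finset.sum_comm]
  refine Finset.sum_congr rfl fun p _ => ?_
  have hp1 : p.rank ≤ finrank F p.1 := Submodule.finrank_mono p.range_map_le
  have hp2 : finrank F p.1 ≤ N := hN ▸ Submodule.finrank_le _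
  rw [Finset.sum_eq_single p.rank, Finset.sum_eq_single (finrank F p.1 - p.rank)]
  · exact if_congr (by omega) rfl rfl
  · exact fun j _ hj => if_neg (by omega)
  · exact fun hj => absurd (Finset.mem_range.2 (by omega)) hj
  · exact fun r _ hr => Finset.sum_eq_zero fun j _ => if_neg (by omega)
  · exact fun hr => absurd (Finset.mem_range.2 (by omega)) hr

end AttenuatedSpace

theorem mainTheorem3 {F H : Type*} [Field F] [Finite F] [AddCommGroup H] [Module F H]
    [FiniteDimensional F H] (q N M : ℕ) (hN : 0 < N) (hM : 0 < M) (hq : Nat.card F = q)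
    (hH : Module.finrank F H = N + M) (h : Submodule F H) (hh : Module.finrank F h = M)
    (i : ℝ) (hi : i ∈ AttenuatedSpace.halfIntegersUpTo N) :
    Module.finrank ℂ (AttenuatedSpace.eigenspaceEV h N M i)
        = Module.finrank ℂ (AttenuatedSpace.eigenspaceEV h N M ((N : ℝ) - i)) ∧
    (i ≤ (N : ℝ) / 2 →
      (∀ n : ℕ, i = (n : ℝ) →
        (Module.finrank ℂ (AttenuatedSpace.eigenspaceEV h N M i) : ℚ)
          = ∑ k ∈ Finset.range (n + 1),
              AttenuatedSpace.mu q N M (2 * k)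
                * AttenuatedSpace.qBinom q (N - 2 * k) (n - k)) ∧
      (∀ n : ℕ, i = (n : ℝ) + 1 / 2 →
        (Module.finrank ℂ (AttenuatedSpace.eigenspaceEV h N M i) : ℚ)
          = ∑ k ∈ Finset.range (n + 1),
              AttenuatedSpace.mu q N M (2 * k + 1)
                * AttenuatedSpace.qBinom q (N - 2 * k - 1) (n - k))) := by
  subst hq
  have hdim {i : ℝ} {a : ℕ} (ha : 2 * i = a) :=
    AttenuatedSpace.finrank_eigenspace_eq_multiplicity (h := h) N M hH hh ha
  refine ⟨?_, fun hiN => ⟨fun n hn => ?_, fun n hn => ?_⟩⟩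
  · obtain ⟨⟨m, hm⟩, hi0, hiN⟩ := hi
    have hm0 : 0 ≤ m := by
      have : (0 : ℝ) ≤ m := by linarith
      exact_mod_cast this
    lift m to ℕ using hm0
    rw [Int.cast_natCast] at hm
    have hmN : m ≤ 2 * N := by
      have : (m : ℝ) ≤ 2 * N := by linarith
      exact_mod_cast this
    have h2 : 2 * ((N : ℝ) - i) = (2 * N - m : ℕ) := by
      rw [Nat.cast_sub hmN]; push_cast; linarith
    have h3 := (hdim hm).trans
      ((AttenuatedSpace.multiplicity_symm hmN).trans (hdim h2).symm)
    exact_mod_cast h3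
  · have h1 : 2 * n + 0 ≤ N := by
      have : (2 * n : ℝ) ≤ N := by linarith
      exact_mod_cast this
    rw [hdim (a := 2 * n + 0) (by rw [hn]; push_cast; ring),
      AttenuatedSpace.multiplicity_eq_sum (by norm_num) h1]
    rfl
  · have h1 : 2 * n + 1 ≤ N := by
      have : (2 * n + 1 : ℝ) ≤ N := by linarith
      exact_mod_cast this
    rw [hdim (a := 2 * n + 1) (by rw [hn]; push_cast; ring),
      AttenuatedSpace.multiplicity_eq_sum (by norm_num) h1]
    simp only [Nat.sub_sub]
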